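/- Let $\mathcal{A}$ and $\mathcal{B}$ be abelian categories and let $F:\mathcal{A}\to\mathcal{B}$ be a faithful functor with a left adjoint $L$ and a right adjoint $R$. (Such an $F$ is automatically additive and exact.) Let $\Delta$ be the class of short exact sequences $X\to Y\to Z$ in $\mathcal{A}$ such that $FX\to FY\to FZ$ is a split short exact sequence in $\mathcal{B}$. Call an object $P$ of $\mathcal{A}$ $\Delta$-projective if $\mathrm{Hom}_{\mathcal{A}}(P,-)$ sends the sequences in $\Delta$ to short exact sequences of abelian groups, and call $I$ $\Delta$-injective if $\mathrm{Hom}_{\mathcal{A}}(-,I)$ does so. 1. $\Delta$ is an exact structure (in the sense of Quillen) on $\mathcal{A}$. It has enough projectives and enough injectives: for every object $X$ there are sequences $X'\to P\to X$ and $X\to I\to X''$ in $\Delta$ with $P$ $\Delta$-projective and $I$ $\Delta$-injective. The $\Delta$-projective objects are exactly the direct summands of objects $LY$, and the $\Delta$-injective objects are exactly the direct summands of objects $RY$, with $Y$ in $\mathcal{B}$. 2. Suppose that the $\Delta$-projective objects and the $\Delta$-injective objects coincide. Let $\underline{\mathcal{A}}_F$ be the category with the objects of $\mathcal{A}$ whose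 morphisms are the morphisms of $\mathcal{A}$ modulo the relation $f\sim g$ if and only if $f-g$ factors through a $\Delta$-projective object. Then $\underline{\mathcal{A}}_F$ carries the structure of a triangulated category (including the octahedral axiom) with the following properties. (a) For every object $X$ and every sequence $X\xrightarrow{\iota} I\xrightarrow{p} X''$ in $\Delta$ with $I$ $\Delta$-injective there is an isomorphism $X[1]\cong X''$ in $\underline{\mathcal{A}}_F$, and these isomorphisms are compatible with morphisms: if $f:X\to Y$, $g:I\to J$, $h:X''\to Y''$ is a morphism in $\mathcal{A}$ from such a sequence to another such sequence $Y\to J\to Y''$, then $f[1]$ corresponds to the class of $h$. (b) The distinguished triangles are the triangles corresponding to the sequences in $\Delta$: a triangle is distinguished if and only if it is isomorphic to a triangle $X\xrightarrow{u}Y\xrightarrow{v}Z\xrightarrow{w}X[1]$ obtained as follows. The sequence $X\xrightarrow{u}Y\xrightarrow{v}Z$ lies in $\Delta$; there are a sequence $X\xrightarrow{\iota}I\xrightarrow{p}X''$ in $\Delta$ with $I$ $\Delta$-injective and morphisms $a:Y\to I$, $b:Z\to X''$ in $\mathcal{A}$ with $a u=\iota$ and $b v=p a$; and $w$ is the composite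 of the class of $b$ with the inverse of the isomorphism $X[1]\cong X''$ of (a). -/

import Mathlib

open CategoryTheory CategoryTheory.Limits
open scoped ZeroObject

universe v u v' u'

namespace RelStable

section ExactStructures

variable {C : Type u} [Category.{v} C] [Preadditive C]

/-- `i` is an inflation for the class `E` of short complexes: it is the first map of a
member of `E`. -/
def IsInflation (E : ObjectProperty (ShortComplex C)) {X Y : C} (i : X ⟶ Y) : Prop :=
  ∃ (Z : C) (p : Y ⟶ Z) (w : i ≫ p = 0), E (ShortComplex.mk i p w)

/-- `p` is a deflation for the class `E` of short complexes: it is the second map of a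
member of `E`. -/
def IsDeflation (E : ObjectProperty (ShortComplex C)) {Y Z : C} (p : Y ⟶ Z) : Prop :=
  ∃ (X : C) (i : X ⟶ Y) (w : i ≫ p = 0), E (ShortComplex.mk i p w)

/-- `E` is an exact structure (in the sense of Quillen) on the additive category `C`: a class of
kernel-cokernel pairs, closed under isomorphisms, such that identities are inflations and
deflations, inflations and deflations are closed under composition, deflations admit pullbacks
along arbitrary morphisms and are stable under them, and dually for pushouts of inflations. -/
structure IsExactStructure (E : ObjectProperty (ShortComplex C)) : Prop where
  closed_iso : E.IsClosedUnderIsomorphisms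
  isKernel : ∀ S : ShortComplex C, E S → Nonempty (IsLimit (KernelFork.ofι S.f S.zero))
  isCokernel : ∀ S : ShortComplex C, E S → Nonempty (IsColimit (CokernelCofork.ofπ S.g S.zero))
  id_inflation : ∀ X : C, IsInflation E (𝟙 X)
  id_deflation : ∀ X : C, IsDeflation E (𝟙 X)
  comp_inflation : ∀ {X Y Z : C} (i : X ⟶ Y) (j : Y ⟶ Z),
    IsInflation E i → IsInflation E j → IsInflation E (i ≫ j)
  comp_deflation : ∀ {X Y Z : C} (p : X ⟶ Y) (q : Y ⟶ Z),
    IsDeflation E p → IsDeflation E q → IsDeflation E (p ≫ q)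
  pullback_deflation : ∀ {Y Z W : C} (p : Y ⟶ Z) (f : W ⟶ Z), IsDeflation E p →
    ∃ (V : C) (g : V ⟶ Y) (q : V ⟶ W), IsPullback g q p f ∧ IsDeflation E q
  pushout_inflation : ∀ {X Y W : C} (i : X ⟶ Y) (f : X ⟶ W), IsInflation E i →
    ∃ (V : C) (g : Y ⟶ V) (j : W ⟶ V), IsPushout i f g j ∧ IsInflation E j

/-- `P` is projective relative to `E`: the functor `Hom(P, -)`, with values in abelian groups,
sends the members of `E` to short exact sequences. -/
def IsRelProjective (E : ObjectProperty (ShortComplex C)) : ObjectProperty C := fun P =>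
  ∀ S : ShortComplex C, E S → (S.map (preadditiveCoyoneda.obj (Opposite.op P))).ShortExact

/-- `I` is injective relative to `E`: the functor `Hom(-, I)`, with values in abelian groups,
sends the members of `E` to short exact sequences. -/
def IsRelInjective (E : ObjectProperty (ShortComplex C)) : ObjectProperty C := fun I =>
  ∀ S : ShortComplex C, E S → (S.op.map (preadditiveYoneda.obj I)).ShortExact

/-- Every object `X` is the end of a member `X' ⟶ P ⟶ X` of `E` with `P` projective. -/
def HasEnoughRelProjectives (E : ObjectProperty (ShortComplex C)) : Prop :=
  ∀ X : C, ∃ (X' P : C) (i : X' ⟶ P) (p : P ⟶ X) (w : i ≫ p = 0),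
    E (ShortComplex.mk i p w) ∧ IsRelProjective E P

/-- A member `X ⟶ I ⟶ Z` of `E` with `I` injective. -/
structure InjectivePresentation (E : ObjectProperty (ShortComplex C)) (X : C) where
  I : C
  Z : C
  ι : X ⟶ I
  p : I ⟶ Z
  w : ι ≫ p = 0
  mem : E (ShortComplex.mk ι p w)
  injective : IsRelInjective E I

/-- Every object `X` is the start of a member `X ⟶ I ⟶ X'` of `E` with `I` injective. -/
def HasEnoughRelInjectives (E : ObjectProperty (ShortComplex C)) : Prop :=
  ∀ X : C, Nonempty (InjectivePresentation E X)

/-- Two parallel morphisms are identified in the stable category when their difference factors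
through a projective object. -/
def stableRel (E : ObjectProperty (ShortComplex C)) : HomRel C := fun X Y f g =>
  ∃ (P : C) (a : X ⟶ P) (b : P ⟶ Y), IsRelProjective E P ∧ f - g = a ≫ b

lemma shortExact_coyoneda_iff (S : ShortComplex C) (P : C) :
    (S.map (preadditiveCoyoneda.obj (Opposite.op P))).ShortExact ↔
      (∀ a b : P ⟶ S.X₁, a ≫ S.f = b ≫ S.f → a = b) ∧
      (∀ b : P ⟶ S.X₂, b ≫ S.g = 0 → ∃ a : P ⟶ S.X₁, a ≫ S.f = b) ∧
      (∀ c : P ⟶ S.X₃, ∃ b : P ⟶ S.X₂, b ≫ S.g = c) := by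
  constructor
  · intro h
    refine ⟨?_, ?_, ?_⟩
    · have := (AddCommGrpCat.mono_iff_injective _).1 h.mono_f
      intro a b hab
      exact this hab
    · have := (ShortComplex.ab_exact_iff _).1 h.exact
      intro b hb
      exact this b hb
    · have := (AddCommGrpCat.epi_iff_surjective _).1 h.epi_g
      intro c
      exact this c
  · rintro ⟨h1, h2, h3⟩
    have m := (AddCommGrpCat.mono_iff_injective
      (S.map (preadditiveCoyoneda.obj (Opposite.op P))).f).2 (fun a b hab => h1 a b hab)
    have e := (AddCommGrpCat.epi_iff_surjective
      (S.map (preadditiveCoyoneda.obj (Opposite.op P))).g).2 (fun c => h3 c)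
    exact
      { exact := (ShortComplex.ab_exact_iff _).2 (fun b hb => h2 b hb)
        mono_f := m
        epi_g := e }

lemma isRelProjective_of_isZero (E : ObjectProperty (ShortComplex C)) {P : C} (hP : IsZero P) :
    IsRelProjective E P := fun S _ =>
  (shortExact_coyoneda_iff S P).2
    ⟨fun _ _ _ => hP.eq_of_src _ _, fun _ _ => ⟨0, hP.eq_of_src _ _⟩,
      fun _ => ⟨0, hP.eq_of_src _ _⟩⟩

lemma isRelProjective_biprod [HasBinaryBiproducts C] (E : ObjectProperty (ShortComplex C))
    {P Q : C} (hP : IsRelProjective E P) (hQ : IsRelProjective E Q) :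
    IsRelProjective E (P ⊞ Q) := by
  intro S hS
  obtain ⟨p1, p2, p3⟩ := (shortExact_coyoneda_iff S P).1 (hP S hS)
  obtain ⟨q1, q2, q3⟩ := (shortExact_coyoneda_iff S Q).1 (hQ S hS)
  refine (shortExact_coyoneda_iff S _).2 ⟨?_, ?_, ?_⟩
  · intro a b hab
    apply biprod.hom_ext'
    · exact p1 _ _ (by simp [hab])
    · exact q1 _ _ (by simp [hab])
  · intro b hb
    obtain ⟨a, ha⟩ := p2 (biprod.inl ≫ b) (by simp [hb])
    obtain ⟨a', ha'⟩ := q2 (biprod.inr ≫ b) (by simp [hb])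
    exact ⟨biprod.desc a a', by apply biprod.hom_ext' <;> simp [ha, ha']⟩
  · intro c
    obtain ⟨a, ha⟩ := p3 (biprod.inl ≫ c)
    obtain ⟨a', ha'⟩ := q3 (biprod.inr ≫ c)
    exact ⟨biprod.desc a a', by apply biprod.hom_ext' <;> simp [ha, ha']⟩

end ExactStructures

section StableCategory

variable {C : Type u} [Category.{v} C] [Preadditive C] [HasBinaryBiproducts C]

lemma stableRel_add (E : ObjectProperty (ShortComplex C)) ⦃X Y : C⦄ (f₁ f₂ g₁ g₂ : X ⟶ Y)
    (hf : stableRel E f₁ f₂) (hg : stableRel E g₁ g₂) :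
    stableRel E (f₁ + g₁) (f₂ + g₂) := by
  obtain ⟨P, a, b, hP, h⟩ := hf
  obtain ⟨Q, c, d, hQ, h'⟩ := hg
  refine ⟨P ⊞ Q, biprod.lift a c, biprod.desc b d, isRelProjective_biprod E hP hQ, ?_⟩
  rw [biprod.lift_desc, ← h, ← h']
  abel

variable [HasZeroObject C]

instance stableRel_congruence (E : ObjectProperty (ShortComplex C)) :
    Congruence (stableRel E) where
  equivalence := fun {X Y} =>
    { refl := fun f => ⟨0, 0, 0, isRelProjective_of_isZero E (isZero_zero C), by simp⟩
      symm := by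
        rintro f g ⟨P, a, b, hP, h⟩
        exact ⟨P, a, -b, hP, by rw [Preadditive.comp_neg, ← h]; abel⟩
      trans := by
        rintro f g k ⟨P, a, b, hP, h⟩ ⟨Q, c, d, hQ, h'⟩
        refine ⟨P ⊞ Q, biprod.lift a c, biprod.desc b d, isRelProjective_biprod E hP hQ, ?_⟩
        rw [biprod.lift_desc, ← h, ← h']
        abel }
  comp_left := by
    rintro X Y Z f g g' ⟨P, a, b, hP, h⟩
    exact ⟨P, f ≫ a, b, hP, by rw [← Preadditive.comp_sub, h, Category.assoc]⟩
  comp_right := by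
    rintro X Y Z f f' g ⟨P, a, b, hP, h⟩
    exact ⟨P, a, b ≫ g, hP, by rw [← Preadditive.sub_comp, h, Category.assoc]⟩

/-- The stable category of `(C, E)`: it has the objects of `C`, and its morphisms are the
morphisms of `C` modulo those that factor through a projective object. -/
abbrev StableCategory (E : ObjectProperty (ShortComplex C)) := Quotient (stableRel E)

/-- The projection from `C` to its stable category. -/
abbrev toStable (E : ObjectProperty (ShortComplex C)) : C ⥤ StableCategory E :=
  Quotient.functor (stableRel E)

instance stablePreadditive (E : ObjectProperty (ShortComplex C)) :
    Preadditive (StableCategory E) :=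
  Quotient.preadditive (stableRel E) (stableRel_add E)

instance toStable_additive (E : ObjectProperty (ShortComplex C)) : (toStable E).Additive :=
  Quotient.functor_additive (stableRel E) (stableRel_add E)

instance stable_hasZeroObject (E : ObjectProperty (ShortComplex C)) :
    HasZeroObject (StableCategory E) :=
  ⟨⟨(toStable E).obj 0, (toStable E).map_isZero (isZero_zero C)⟩⟩

end StableCategory

/-- The short exact sequences of `A` that become split short exact upon applying `F`. -/
def SplitBy {A : Type u} [Category.{v} A] [Abelian A] {B : Type u'} [Category.{v'} B] [Abelian B]
    (F : A ⥤ B) [F.PreservesZeroMorphisms] : ObjectProperty (ShortComplex A) := fun S =>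
  S.ShortExact ∧ Nonempty (S.map F).Splitting

end RelStable

/-!
The theorem splits into a relative homological part about `F`, and a general part producing a
triangulated category from a Frobenius exact structure.

*The exact structure.* A short exact sequence `S` is split by `F` if and only if the image under `F`
of its second map has a section. By adjunction, objects `LY` are then relatively projective, and
conversely if the counit `LFZ ⟶ Z` lifts along the second map of `S`, the lift composed with the
unit at `FZ` is such a section. Faithfulness of `F` makes the counit an epimorphism, so there are
enough projectives, and dually enough injectives. The class is therefore *detected*
(`IsDetected`): a short exact sequence belongs to it as soon as projectives lift along its second
map, or as soon as injectives extend along its first map. These lifting properties are visibly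
stable under composition and base change, which gives `IsDetected.isExactStructure`.

*The suspension.* Assume that projectives and injectives coincide. A morphism from the first term of
a sequence `S` in the class to an object `Y` extends to a morphism from `S` to any injective
presentation of `Y`, and the stable class of the resulting map of third terms depends only on the
stable class of the given morphism (`IsFrobenius.connecting_eq`). Applied to injective presentations
this defines the suspension; applied to the identity of the first term it defines the connecting
morphism of `S`. The suspension is an equivalence since injective presentations are also projective
presentations, and an autoequivalence `Φ` of a category `D` extends to a shift by `ℤ`
(`exists_hasShift_of_isEquivalence`): `D` is equivalent to the category of sequences of objects
`X n` with isomorphisms `Φ (X n) ≅ X (n + 1)`, on which `ℤ` acts by reindexing.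

*The triangles.* Every axiom is proved for triangles of actual sequences in the class. Two facts do
the work: the connecting morphism is natural in the sequence (`IsFrobenius.boundary_naturality`), and
stably trivial morphisms extend along inflations, so a stably commutative square between inflations
can be made to commute strictly (`IsFrobenius.exists_shortComplex_hom`). Adding an injective summand
to the target turns every morphism into an inflation, which gives cones, and reduces the octahedral
axiom to the cokernel sequence of two composable inflations. Rotation in either direction comes from
a bicartesian square (`IsFrobenius.rotated_mem`, `IsFrobenius.invRotated_mem`).
-/

namespace RelStable

/-! ### Integer shifts from an autoequivalence -/

section Spectra

variable {D : Type u} [Category.{v} D]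

/-- A `ℤ`-indexed sequence of objects together with isomorphisms from the image under `S` of each
term to the next term. The target index `m` of `str` is a variable constrained by `n + 1 = m`, so
that reindexing by a translation involves no transport. -/
structure Spectrum (S : D ⥤ D) where
  obj : ℤ → D
  str : ∀ n m : ℤ, n + 1 = m → (S.obj (obj n) ≅ obj m)

namespace Spectrum

variable {S : D ⥤ D}

/-- A morphism of spectra is a family of morphisms compatible with the structure isomorphisms. -/
@[ext]
structure Hom (X Y : Spectrum S) where
  app : ∀ n : ℤ, X.obj n ⟶ Y.obj n
  comm : ∀ (n m : ℤ) (h : n + 1 = m),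
    S.map (app n) ≫ (Y.str n m h).hom = (X.str n m h).hom ≫ app m

instance : Category (Spectrum S) where
  Hom := Hom
  id X := { app := fun _ => 𝟙 _, comm := by simp }
  comp f g :=
    { app := fun n => f.app n ≫ g.app n
      comm := fun n m h => by
        rw [Functor.map_comp, Category.assoc, g.comm, ← Category.assoc, f.comm, Category.assoc] }
  id_comp f := by apply Hom.ext; funext n; exact Category.id_comp _
  comp_id f := by apply Hom.ext; funext n; exact Category.comp_id _
  assoc f g h := by apply Hom.ext; funext n; exact Category.assoc _ _ _

@[ext]
lemma hom_ext {X Y : Spectrum S} {f g : X ⟶ Y} (h : ∀ n, f.app n = g.app n) : f = g :=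
  Hom.ext (funext h)

@[simp] lemma id_app (X : Spectrum S) (n : ℤ) : Hom.app (𝟙 X) n = 𝟙 (X.obj n) := rfl

@[simp] lemma comp_app {X Y Z : Spectrum S} (f : X ⟶ Y) (g : Y ⟶ Z) (n : ℤ) :
    (f ≫ g).app n = f.app n ≫ g.app n := rfl

/-- The isomorphism of spectra given by a compatible family of isomorphisms. -/
@[simps]
def isoMk {X Y : Spectrum S} (e : ∀ n, X.obj n ≅ Y.obj n)
    (h : ∀ (n m : ℤ) (h : n + 1 = m),
      S.map (e n).hom ≫ (Y.str n m h).hom = (X.str n m h).hom ≫ (e m).hom) : X ≅ Y where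
  hom := { app := fun n => (e n).hom, comm := h }
  inv :=
    { app := fun n => (e n).inv
      comm := fun n m hnm => by
        rw [← cancel_epi (S.map (e n).hom), ← Functor.map_comp_assoc, Iso.hom_inv_id,
          S.map_id, Category.id_comp, ← Category.assoc, h, Category.assoc, Iso.hom_inv_id,
          Category.comp_id] }
  hom_inv_id := by ext n; simp
  inv_hom_id := by ext n; simp

lemma str_eqToHom (X : Spectrum S) {n n' m m' : ℤ} (h : n + 1 = m) (h' : n' + 1 = m')
    (hn : n = n') :
    S.map (eqToHom (congrArg X.obj hn)) ≫ (X.str n' m' h').hom =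
      (X.str n m h).hom ≫ eqToHom (congrArg X.obj (by omega)) := by
  subst h h' hn
  simp

lemma app_eqToHom {X Y : Spectrum S} (f : X ⟶ Y) {n m : ℤ} (h : n = m) :
    f.app n ≫ eqToHom (congrArg Y.obj h) = eqToHom (congrArg X.obj h) ≫ f.app m := by
  subst h
  simp

variable (S) in
/-- Translation of spectra by `a`. -/
@[simps]
def translate (a : ℤ) : Spectrum S ⥤ Spectrum S where
  obj X :=
    { obj := fun n => X.obj (n + a)
      str := fun n m h => X.str (n + a) (m + a) (by omega) }
  map f :=
    { app := fun n => f.app (n + a)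
      comm := fun n m h => f.comm _ _ _ }

lemma eqToHom_translate_app {a b : ℤ} (h : a = b) (X : Spectrum S) (n : ℤ) :
    Hom.app (eqToHom (by rw [h]) : (translate S a).obj X ⟶ (translate S b).obj X) n =
      eqToHom (congrArg X.obj (by rw [h])) := by
  subst h
  rfl

variable (S) in
/-- Translation by zero is isomorphic to the identity. -/
def translateZero : translate S 0 ≅ 𝟭 (Spectrum S) :=
  NatIso.ofComponents
    (fun X => isoMk (fun n => eqToIso (congrArg X.obj (add_zero n)))
      (fun n _ _ => X.str_eqToHom _ _ (add_zero n)))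
    (fun f => by ext n; exact app_eqToHom f (add_zero n))

variable (S) in
/-- Translation by a sum is isomorphic to the composite of the translations. -/
def translateAdd (a b : ℤ) : translate S (a + b) ≅ translate S a ⋙ translate S b :=
  NatIso.ofComponents
    (fun X => isoMk (fun n => eqToIso (congrArg X.obj (show n + (a + b) = n + b + a by omega)))
      (fun n _ _ => X.str_eqToHom _ _ (show n + (a + b) = n + b + a by omega)))
    (fun f => by ext n; exact app_eqToHom f (show n + (a + b) = n + b + a by omega))

variable (S) in
/-- Translations of spectra satisfy the coherence conditions of a shift. -/
def shiftCore : ShiftMkCore (Spectrum S) ℤ where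
  F := translate S
  zero := translateZero S
  add := translateAdd S
  assoc_hom_app a b c X := by
    ext n
    rw [comp_app, comp_app, comp_app, eqToHom_translate_app (add_assoc a b c)]
    -- All five morphisms are transports between terms of `X`.
    have key : ∀ {i j k l m : ℤ} (h₁ : i = j) (h₂ : j = m) (h₃ : i = k) (h₄ : k = l) (h₅ : l = m),
        eqToHom (congrArg X.obj h₁) ≫ eqToHom (congrArg X.obj h₂) =
          eqToHom (congrArg X.obj h₃) ≫ eqToHom (congrArg X.obj h₄) ≫
            eqToHom (congrArg X.obj h₅) := by
      intros; simp
    exact key (show n + (a + b + c) = n + c + (a + b) by omega)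
      (show n + c + (a + b) = n + c + b + a by omega)
      (show n + (a + b + c) = n + (a + (b + c)) by omega)
      (show n + (a + (b + c)) = n + (b + c) + a by omega)
      (show n + (b + c) + a = n + c + b + a by omega)
  zero_add_hom_app a X := by
    ext n
    rw [comp_app]
    refine Eq.symm ((congrArg (· ≫ _) (eqToHom_translate_app (zero_add a) X n)).trans ?_)
    have key : ∀ {i j k : ℤ} (h₁ : i = j) (h₂ : j = k), eqToHom (congrArg X.obj h₁) ≫
        eqToHom (congrArg X.obj h₂) = eqToHom (congrArg X.obj (h₁.trans h₂)) := by
      intros; simp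
    exact key (show n + (0 + a) = n + a by omega) (show n + a = n + a + 0 by omega)
  add_zero_hom_app a X := by
    ext n
    rw [comp_app]
    refine Eq.symm ((congrArg (· ≫ _) (eqToHom_translate_app (add_zero a) X n)).trans ?_)
    have key : ∀ {i j k : ℤ} (h₁ : i = j) (h₂ : j = k), eqToHom (congrArg X.obj h₁) ≫
        eqToHom (congrArg X.obj h₂) = eqToHom (congrArg X.obj (h₁.trans h₂)) := by
      intros; simp
    exact key (show n + (a + 0) = n + a by omega) (show n + a = n + 0 + a by omega)

instance : HasShift (Spectrum S) ℤ := hasShiftMk _ _ (shiftCore S)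

variable (S) in
/-- The functor sending a spectrum to its term of index `0`. It is an equivalence when `S` is one. -/
@[simps]
def evalZero : Spectrum S ⥤ D where
  obj X := X.obj 0
  map f := f.app 0

instance [S.Faithful] : (evalZero S).Faithful where
  map_injective {X Y f g} hfg := by
    have up : ∀ n, f.app n = g.app n → f.app (n + 1) = g.app (n + 1) := fun n h => by
      rw [← cancel_epi (X.str n (n + 1) rfl).hom, ← f.comm, ← g.comm, h]
    have down : ∀ n, f.app (n + 1) = g.app (n + 1) → f.app n = g.app n := fun n h => by
      apply S.map_injective
      rw [← cancel_mono (Y.str n (n + 1) rfl).hom, f.comm, g.comm, h]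
    ext n
    induction n using Int.induction_on with
    | zero => exact hfg
    | succ n ih => exact up _ ih
    | pred n ih => exact down _ (by rw [sub_add_cancel]; exact ih)

/-- A morphism between terms of index `0` extends uniquely upwards because the structure maps are
isomorphisms, and downwards because `S` is fully faithful. -/
instance [S.Full] : (evalZero S).Full where
  map_surjective {X Y} φ := by
    let R (n : ℤ) (f : X.obj n ⟶ Y.obj n) (m : ℤ) (g : X.obj m ⟶ Y.obj m) : Prop :=
      ∀ h : n + 1 = m, S.map f ≫ (Y.str n m h).hom = (X.str n m h).hom ≫ g
    have up : ∀ n f, ∃ g, R n f (n + 1) g := fun n f =>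
      ⟨(X.str n (n + 1) rfl).inv ≫ S.map f ≫ (Y.str n (n + 1) rfl).hom, fun h => by simp⟩
    have down : ∀ n g, ∃ f, R (n - 1) f n g := fun n g => by
      have h : n - 1 + 1 = n := by omega
      refine ⟨S.preimage ((X.str _ _ h).hom ≫ g ≫ (Y.str _ _ h).inv), fun h => by simp⟩
    choose u hu using up
    choose d hd using down
    let F (n : ℤ) : X.obj n ⟶ Y.obj n :=
      Int.inductionOn' (motive := fun n => X.obj n ⟶ Y.obj n) n 0 φ
        (fun k _ f => u k f) (fun k _ g => d k g)
    have h0 : F 0 = φ := Int.inductionOn'_self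
    have hup : ∀ n, 0 ≤ n → F (n + 1) = u n (F n) := fun n hn => Int.inductionOn'_add_one hn
    have hdown : ∀ n, n ≤ 0 → F (n - 1) = d n (F n) := fun n hn => Int.inductionOn'_sub_one hn
    refine ⟨{ app := F, comm := ?_ }, h0⟩
    intro n m h
    rcases le_or_gt 0 n with hn | hn
    · subst h
      rw [hup n hn]
      exact hu n _ rfl
    · obtain rfl : n = m - 1 := by omega
      rw [hdown m (by omega)]
      exact hd m _ h

/-- Positive terms are obtained by iterating `S`, negative ones by iterating a quasi-inverse. -/
instance [S.IsEquivalence] : (evalZero S).EssSurj where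
  mem_essImage X := by
    let o : ℤ → D := fun n => match n with
      | Int.ofNat n => S.obj^[n] X
      | Int.negSucc n => S.inv.obj^[n + 1] X
    have s : ∀ n : ℤ, Nonempty (S.obj (o n) ≅ o (n + 1)) := fun n => match n with
      | Int.ofNat n => ⟨eqToIso (Function.iterate_succ_apply' S.obj n X).symm⟩
      | Int.negSucc 0 => ⟨S.asEquivalence.counitIso.app X⟩
      | Int.negSucc (n + 1) =>
        ⟨S.mapIso (eqToIso (Function.iterate_succ_apply' S.inv.obj (n + 1) X)) ≪≫
          S.asEquivalence.counitIso.app _⟩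
    exact ⟨{ obj := o, str := fun n m h => (s n).some ≪≫ eqToIso (by rw [h]) }, ⟨Iso.refl _⟩⟩

instance [S.IsEquivalence] : (evalZero S).IsEquivalence where

variable (S) in
/-- The translation by one is the functor `S` on terms of index `0`. -/
def translateOneIso : translate S 1 ⋙ evalZero S ≅ evalZero S ⋙ S :=
  NatIso.ofComponents (fun X => (X.str 0 (0 + 1) rfl).symm) (fun {X Y} f => by
    have h := f.comm 0 (0 + 1) rfl
    rw [← Iso.eq_comp_inv, Category.assoc, ← Iso.inv_comp_eq] at h
    exact h.symm)

end Spectrum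

/-- An autoequivalence `S` of a category extends to a shift by the integers. -/
theorem exists_hasShift_of_isEquivalence (S : D ⥤ D) [S.IsEquivalence] :
    ∃ _ : HasShift D ℤ, Nonempty (shiftFunctor D (1 : ℤ) ≅ S) := by
  let G := (Spectrum.evalZero S).inv
  let ε := (Spectrum.evalZero S).asEquivalence.unitIso
  let η : G ⋙ Spectrum.evalZero S ≅ 𝟭 D := (Spectrum.evalZero S).asEquivalence.counitIso
  let s : ℤ → D ⥤ D := fun a => G ⋙ Spectrum.translate S a ⋙ Spectrum.evalZero S
  let i : ∀ a, s a ⋙ G ≅ G ⋙ shiftFunctor (Spectrum S) a := fun a =>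
    (Functor.isoWhiskerLeft (G ⋙ Spectrum.translate S a) ε.symm :
      _ ≅ (G ⋙ Spectrum.translate S a) ⋙ 𝟭 _) ≪≫ Functor.rightUnitor _
  refine ⟨(Functor.FullyFaithful.ofFullyFaithful G).hasShift s i, ⟨?_⟩⟩
  exact Functor.isoWhiskerLeft G (Spectrum.translateOneIso S) ≪≫
    (Functor.associator _ _ _).symm ≪≫ Functor.isoWhiskerRight η S ≪≫ Functor.leftUnitor _

/-- If the shift by one is additive, so are all shifts. -/
lemma shiftFunctor_additive [Preadditive D] [HasShift D ℤ]
    [(shiftFunctor D (1 : ℤ)).Additive] (n : ℤ) : (shiftFunctor D n).Additive := by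
  have inv : (shiftFunctor D (-1 : ℤ)).Additive :=
    have : (shiftEquiv D (1 : ℤ)).functor.Additive := ‹(shiftFunctor D (1 : ℤ)).Additive›
    (shiftEquiv D (1 : ℤ)).inverse_additive
  induction n using Int.induction_on with
  | zero => exact Functor.additive_of_iso (shiftFunctorZero D ℤ).symm
  | succ n ih => exact Functor.additive_of_iso (shiftFunctorAdd D (n : ℤ) 1).symm
  | pred n ih => exact Functor.additive_of_iso (shiftFunctorAdd D (-n : ℤ) (-1)).symm

end Spectra

/-! ### Exact structures detected by projectives and injectives -/

section Detected

variable {C : Type u} [Category.{v} C] [Abelian C] {E : ObjectProperty (ShortComplex C)}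

lemma IsRelProjective.exists_lift {P : C} (hP : IsRelProjective E P) {S : ShortComplex C}
    (hS : E S) (c : P ⟶ S.X₃) : ∃ b : P ⟶ S.X₂, b ≫ S.g = c :=
  ((shortExact_coyoneda_iff S P).1 (hP S hS)).2.2 c

lemma shortExact_yoneda_iff (S : ShortComplex C) (I : C) :
    (S.op.map (preadditiveYoneda.obj I)).ShortExact ↔
      (∀ a b : S.X₃ ⟶ I, S.g ≫ a = S.g ≫ b → a = b) ∧
      (∀ b : S.X₂ ⟶ I, S.f ≫ b = 0 → ∃ a : S.X₃ ⟶ I, S.g ≫ a = b) ∧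
      (∀ c : S.X₁ ⟶ I, ∃ b : S.X₂ ⟶ I, S.f ≫ b = c) := by
  constructor
  · intro h
    refine ⟨?_, ?_, ?_⟩
    · have := (AddCommGrpCat.mono_iff_injective _).1 h.mono_f
      exact fun a b hab => this hab
    · have := (ShortComplex.ab_exact_iff _).1 h.exact
      exact fun b hb => this b hb
    · have := (AddCommGrpCat.epi_iff_surjective _).1 h.epi_g
      exact fun c => this c
  · rintro ⟨h1, h2, h3⟩
    exact
      { exact := (ShortComplex.ab_exact_iff _).2 (fun b hb => h2 b hb)
        mono_f := (AddCommGrpCat.mono_iff_injective _).2 (fun a b hab => h1 a b hab)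
        epi_g := (AddCommGrpCat.epi_iff_surjective _).2 (fun c => h3 c) }

lemma IsRelInjective.exists_extension {I : C} (hI : IsRelInjective E I) {S : ShortComplex C}
    (hS : E S) (c : S.X₁ ⟶ I) : ∃ b : S.X₂ ⟶ I, S.f ≫ b = c :=
  ((shortExact_yoneda_iff S I).1 (hI S hS)).2.2 c

lemma isRelProjective_of_exists_lift (hE : ∀ S, E S → S.ShortExact) {P : C}
    (h : ∀ S : ShortComplex C, E S → ∀ c : P ⟶ S.X₃, ∃ b : P ⟶ S.X₂, b ≫ S.g = c) :
    IsRelProjective E P := fun S hS => by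
  have hS' := hE S hS
  have := hS'.mono_f
  exact (shortExact_coyoneda_iff S P).2 ⟨fun a b hab => (cancel_mono S.f).1 hab,
    fun b hb => ⟨hS'.exact.lift b hb, hS'.exact.lift_f b hb⟩, h S hS⟩

lemma isRelInjective_of_exists_extension (hE : ∀ S, E S → S.ShortExact) {I : C}
    (h : ∀ S : ShortComplex C, E S → ∀ c : S.X₁ ⟶ I, ∃ b : S.X₂ ⟶ I, S.f ≫ b = c) :
    IsRelInjective E I := fun S hS => by
  have hS' := hE S hS
  have := hS'.epi_g
  exact (shortExact_yoneda_iff S I).2 ⟨fun a b hab => (cancel_epi S.g).1 hab,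
    fun b hb => ⟨hS'.exact.desc b hb, hS'.exact.g_desc b hb⟩, h S hS⟩

/-- A class of short exact sequences with enough relative projectives and injectives, such that a
short exact sequence belongs to the class as soon as all relative projectives lift along its second
map, or all relative injectives extend along its first map. -/
structure IsDetected (E : ObjectProperty (ShortComplex C)) : Prop where
  shortExact : ∀ S, E S → S.ShortExact
  of_lift : ∀ S : ShortComplex C, S.ShortExact → (∀ P, IsRelProjective E P →
    ∀ c : P ⟶ S.X₃, ∃ b : P ⟶ S.X₂, b ≫ S.g = c) → E S
  of_extension : ∀ S : ShortComplex C, S.ShortExact → (∀ I, IsRelInjective E I →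
    ∀ c : S.X₁ ⟶ I, ∃ b : S.X₂ ⟶ I, S.f ≫ b = c) → E S
  enoughProjectives : HasEnoughRelProjectives E
  enoughInjectives : HasEnoughRelInjectives E

namespace IsDetected

variable (hE : IsDetected E)
include hE

lemma mono_of_extension {X Y : C} {i : X ⟶ Y}
    (h : ∀ I, IsRelInjective E I → ∀ c : X ⟶ I, ∃ b : Y ⟶ I, i ≫ b = c) : Mono i := by
  obtain ⟨H⟩ := hE.enoughInjectives X
  obtain ⟨b, hb⟩ := h H.I H.injective H.ι
  have : Mono H.ι := (hE.shortExact _ H.mem).mono_f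
  exact mono_of_mono_fac hb

lemma epi_of_lift {Y Z : C} {p : Y ⟶ Z}
    (h : ∀ P, IsRelProjective E P → ∀ c : P ⟶ Z, ∃ b : P ⟶ Y, b ≫ p = c) : Epi p := by
  obtain ⟨X', P, i, q, w, hq, hP⟩ := hE.enoughProjectives Z
  obtain ⟨b, hb⟩ := h P hP q
  have : Epi q := (hE.shortExact _ hq).epi_g
  exact epi_of_epi_fac hb

/-- A cokernel sequence along whose first map relative injectives extend is in the class. -/
lemma mem_of_isColimit (S : ShortComplex C) (hc : IsColimit (CokernelCofork.ofπ S.g S.zero))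
    (h : ∀ I, IsRelInjective E I → ∀ c : S.X₁ ⟶ I, ∃ b : S.X₂ ⟶ I, S.f ≫ b = c) : E S :=
  hE.of_extension S
    { exact := S.exact_of_g_is_cokernel hc
      mono_f := hE.mono_of_extension h
      epi_g := Cofork.IsColimit.epi hc } h

/-- A kernel sequence along whose second map relative projectives lift is in the class. -/
lemma mem_of_isLimit (S : ShortComplex C) (hc : IsLimit (KernelFork.ofι S.f S.zero))
    (h : ∀ P, IsRelProjective E P → ∀ c : P ⟶ S.X₃, ∃ b : P ⟶ S.X₂, b ≫ S.g = c) : E S :=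
  hE.of_lift S
    { exact := S.exact_of_f_is_kernel hc
      mono_f := Fork.IsLimit.mono hc
      epi_g := hE.epi_of_lift h } h

lemma cokernel_mem {X Y : C} (i : X ⟶ Y)
    (h : ∀ I, IsRelInjective E I → ∀ c : X ⟶ I, ∃ b : Y ⟶ I, i ≫ b = c) :
    E (ShortComplex.mk i (cokernel.π i) (cokernel.condition i)) :=
  hE.mem_of_isColimit (ShortComplex.mk i (cokernel.π i) (cokernel.condition i))
    (cokernelIsCokernel i) h

lemma kernel_mem {Y Z : C} (p : Y ⟶ Z)
    (h : ∀ P, IsRelProjective E P → ∀ c : P ⟶ Z, ∃ b : P ⟶ Y, b ≫ p = c) :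
    E (ShortComplex.mk (kernel.ι p) p (kernel.condition p)) :=
  hE.mem_of_isLimit (ShortComplex.mk (kernel.ι p) p (kernel.condition p)) (kernelIsKernel p) h

lemma isInflation_iff {X Y : C} (i : X ⟶ Y) :
    IsInflation E i ↔ ∀ I, IsRelInjective E I → ∀ c : X ⟶ I, ∃ b : Y ⟶ I, i ≫ b = c :=
  ⟨fun ⟨_, _, _, h⟩ _ hI c => hI.exists_extension h c, fun h => ⟨_, _, _, hE.cokernel_mem i h⟩⟩

lemma isDeflation_iff {Y Z : C} (p : Y ⟶ Z) :
    IsDeflation E p ↔ ∀ P, IsRelProjective E P → ∀ c : P ⟶ Z, ∃ b : P ⟶ Y, b ≫ p = c :=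
  ⟨fun ⟨_, _, _, h⟩ _ hP c => hP.exists_lift h c, fun h => ⟨_, _, _, hE.kernel_mem p h⟩⟩

/-- The lifting and extension properties that characterize deflations and inflations are stable
under composition and under pullback or pushout. -/
theorem isExactStructure : IsExactStructure E where
  closed_iso :=
    { of_iso := by
        intro S T e hS
        refine hE.of_lift T (ShortComplex.shortExact_of_iso e (hE.shortExact S hS)) ?_
        intro P hP c
        obtain ⟨b, hb⟩ := hP.exists_lift hS (c ≫ e.inv.τ₃)
        refine ⟨b ≫ e.hom.τ₂, ?_⟩
        rw [Category.assoc, e.hom.comm₂₃, reassoc_of% hb, ← ShortComplex.comp_τ₃, e.inv_hom_id,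
          ShortComplex.id_τ₃, Category.comp_id] }
  isKernel S hS := by
    have := (hE.shortExact S hS).mono_f
    exact ⟨(hE.shortExact S hS).exact.fIsKernel⟩
  isCokernel S hS := by
    have := (hE.shortExact S hS).epi_g
    exact ⟨(hE.shortExact S hS).exact.gIsCokernel⟩
  id_inflation X := (hE.isInflation_iff _).2 fun _ _ c => ⟨c, Category.id_comp _⟩
  id_deflation X := (hE.isDeflation_iff _).2 fun _ _ c => ⟨c, Category.comp_id _⟩
  comp_inflation i j hi hj := by
    rw [hE.isInflation_iff] at hi hj ⊢
    intro I hI c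
    obtain ⟨b, rfl⟩ := hi I hI c
    obtain ⟨d, rfl⟩ := hj I hI b
    exact ⟨d, Category.assoc _ _ _⟩
  comp_deflation p q hp hq := by
    rw [hE.isDeflation_iff] at hp hq ⊢
    intro P hP c
    obtain ⟨b, rfl⟩ := hq P hP c
    obtain ⟨d, rfl⟩ := hp P hP b
    exact ⟨d, (Category.assoc _ _ _).symm⟩
  pullback_deflation p f hp := by
    refine ⟨pullback p f, pullback.fst p f, pullback.snd p f, IsPullback.of_hasPullback p f, ?_⟩
    rw [hE.isDeflation_iff] at hp ⊢
    intro P hP c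
    obtain ⟨b, hb⟩ := hp P hP (c ≫ f)
    exact ⟨pullback.lift b c hb, pullback.lift_snd _ _ _⟩
  pushout_inflation i f hi := by
    refine ⟨pushout i f, pushout.inl i f, pushout.inr i f, IsPushout.of_hasPushout i f, ?_⟩
    rw [hE.isInflation_iff] at hi ⊢
    intro I hI c
    obtain ⟨b, hb⟩ := hi I hI (f ≫ c)
    exact ⟨pushout.desc b c hb, pushout.inr_desc _ _ _⟩

end IsDetected

end Detected

/-! ### Sequences split by a functor with both adjoints -/

section SplitBy

variable {A : Type u} [Category.{v} A] [Abelian A] {B : Type u'} [Category.{v'} B] [Abelian B]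
  (F : A ⥤ B) [F.Faithful] [F.IsLeftAdjoint] [F.IsRightAdjoint]

variable {F} in
omit [F.Faithful] [F.IsLeftAdjoint] in
lemma SplitBy.shortExact {S : ShortComplex A} (hS : SplitBy F S) : S.ShortExact := hS.1

omit [F.Faithful] in
lemma map_shortExact {S : ShortComplex A} (hS : S.ShortExact) : (S.map F).ShortExact := by
  have := preservesBinaryBiproducts_of_preservesBinaryProducts F
  have := Functor.additive_of_preservesBinaryBiproducts F
  exact hS.map_of_exact F

omit [F.Faithful] in
lemma splitBy_of_section {S : ShortComplex A} (hS : S.ShortExact) (s : F.obj S.X₃ ⟶ F.obj S.X₂)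
    (hs : s ≫ F.map S.g = 𝟙 _) : SplitBy F S :=
  ⟨hS, ⟨ShortComplex.Splitting.ofExactOfSection _ (map_shortExact F hS).exact s hs
    (map_shortExact F hS).mono_f⟩⟩

omit [F.Faithful] in
lemma splitBy_of_retraction {S : ShortComplex A} (hS : S.ShortExact)
    (r : F.obj S.X₂ ⟶ F.obj S.X₁) (hr : F.map S.f ≫ r = 𝟙 _) : SplitBy F S :=
  ⟨hS, ⟨ShortComplex.Splitting.ofExactOfRetraction _ (map_shortExact F hS).exact r hr
    (map_shortExact F hS).epi_g⟩⟩

omit [F.Faithful] [F.IsLeftAdjoint] in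
lemma leftAdjoint_isRelProjective (Y : B) :
    IsRelProjective (SplitBy F) (F.leftAdjoint.obj Y) := by
  refine isRelProjective_of_exists_lift (fun _ hS => hS.shortExact) ?_
  rintro S ⟨-, ⟨σ⟩⟩ c
  obtain ⟨s, hs⟩ : ∃ s : F.obj S.X₃ ⟶ F.obj S.X₂, s ≫ F.map S.g = 𝟙 _ := ⟨σ.s, σ.s_g⟩
  let adj := Adjunction.ofIsRightAdjoint F
  refine ⟨(adj.homEquiv _ _).symm (adj.homEquiv _ _ c ≫ s), ?_⟩
  apply (adj.homEquiv _ _).injective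
  rw [adj.homEquiv_naturality_right, Equiv.apply_symm_apply, Category.assoc, hs,
    Category.comp_id]

omit [F.Faithful] [F.IsRightAdjoint] in
lemma rightAdjoint_isRelInjective [F.PreservesZeroMorphisms] (Y : B) :
    IsRelInjective (SplitBy F) (F.rightAdjoint.obj Y) := by
  refine isRelInjective_of_exists_extension (fun _ hS => hS.1) ?_
  rintro S ⟨-, ⟨σ⟩⟩ c
  obtain ⟨r, hr⟩ : ∃ r : F.obj S.X₂ ⟶ F.obj S.X₁, F.map S.f ≫ r = 𝟙 _ := ⟨σ.r, σ.f_r⟩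
  let adj := Adjunction.ofIsLeftAdjoint F
  refine ⟨adj.homEquiv _ _ (r ≫ (adj.homEquiv _ _).symm c), ?_⟩
  apply (adj.homEquiv _ _).symm.injective
  rw [adj.homEquiv_naturality_left_symm, Equiv.symm_apply_apply, ← Category.assoc, hr,
    Category.id_comp]

/-- The counit `LFX ⟶ X` is an epimorphism because `F` is faithful, and the unit of the adjunction
at `FX` splits its image under `F`. -/
lemma splitBy_counit (X : A) :
    SplitBy F (ShortComplex.mk (kernel.ι ((Adjunction.ofIsRightAdjoint F).counit.app X))
      ((Adjunction.ofIsRightAdjoint F).counit.app X) (kernel.condition _)) :=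
  splitBy_of_section F
    { exact := ShortComplex.exact_of_f_is_kernel _ (kernelIsKernel _)
      mono_f := inferInstanceAs (Mono (kernel.ι _))
      epi_g := inferInstanceAs (Epi ((Adjunction.ofIsRightAdjoint F).counit.app X)) }
    ((Adjunction.ofIsRightAdjoint F).unit.app (F.obj X))
    ((Adjunction.ofIsRightAdjoint F).right_triangle_components X)

/-- The unit `X ⟶ RFX` is a monomorphism because `F` is faithful, and the counit of the adjunction
at `FX` splits its image under `F`. -/
lemma splitBy_unit (X : A) :
    SplitBy F (ShortComplex.mk ((Adjunction.ofIsLeftAdjoint F).unit.app X)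
      (cokernel.π ((Adjunction.ofIsLeftAdjoint F).unit.app X)) (cokernel.condition _)) :=
  splitBy_of_retraction F
    { exact := ShortComplex.exact_of_g_is_cokernel _ (cokernelIsCokernel _)
      mono_f := inferInstanceAs (Mono ((Adjunction.ofIsLeftAdjoint F).unit.app X))
      epi_g := inferInstanceAs (Epi (cokernel.π _)) }
    ((Adjunction.ofIsLeftAdjoint F).counit.app (F.obj X))
    ((Adjunction.ofIsLeftAdjoint F).left_triangle_components X)

omit [F.Faithful] in
lemma splitBy_of_lift {S : ShortComplex A} (hS : S.ShortExact)
    (h : ∀ P, IsRelProjective (SplitBy F) P →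
      ∀ c : P ⟶ S.X₃, ∃ b : P ⟶ S.X₂, b ≫ S.g = c) : SplitBy F S := by
  let adj := Adjunction.ofIsRightAdjoint F
  obtain ⟨b, hb⟩ := h _ (leftAdjoint_isRelProjective F (F.obj S.X₃)) (adj.counit.app S.X₃)
  refine splitBy_of_section F hS (adj.unit.app (F.obj S.X₃) ≫ F.map b) ?_
  rw [Category.assoc, ← F.map_comp, hb]
  exact adj.right_triangle_components S.X₃

omit [F.Faithful] in
lemma splitBy_of_extension {S : ShortComplex A} (hS : S.ShortExact)
    (h : ∀ I, IsRelInjective (SplitBy F) I →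
      ∀ c : S.X₁ ⟶ I, ∃ b : S.X₂ ⟶ I, S.f ≫ b = c) : SplitBy F S := by
  let adj := Adjunction.ofIsLeftAdjoint F
  obtain ⟨b, hb⟩ := h _ (rightAdjoint_isRelInjective F (F.obj S.X₁)) (adj.unit.app S.X₁)
  refine splitBy_of_retraction F hS (F.map b ≫ adj.counit.app (F.obj S.X₁)) ?_
  rw [← Category.assoc, ← F.map_comp, hb]
  exact adj.left_triangle_components S.X₁

theorem splitBy_isDetected : IsDetected (SplitBy F) where
  shortExact _ hS := hS.shortExact
  of_lift _ hS h := splitBy_of_lift F hS h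
  of_extension _ hS h := splitBy_of_extension F hS h
  enoughProjectives X :=
    ⟨_, _, _, _, _, splitBy_counit F X, leftAdjoint_isRelProjective F (F.obj X)⟩
  enoughInjectives X :=
    ⟨⟨_, _, _, _, _, splitBy_unit F X, rightAdjoint_isRelInjective F (F.obj X)⟩⟩

lemma isRelProjective_iff (P : A) : IsRelProjective (SplitBy F) P ↔
    ∃ (Y : B) (Q : A), Nonempty (P ⊞ Q ≅ F.leftAdjoint.obj Y) := by
  constructor
  · intro hP
    have hS := splitBy_counit F P
    obtain ⟨b, hb⟩ := hP.exists_lift hS (𝟙 P)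
    have s := ShortComplex.Splitting.ofExactOfSection _ hS.shortExact.exact b hb
      hS.shortExact.mono_f
    exact ⟨F.obj P, _, ⟨biprod.braiding _ _ ≪≫ s.isoBinaryBiproduct.symm⟩⟩
  · rintro ⟨Y, Q, ⟨e⟩⟩
    refine isRelProjective_of_exists_lift (fun _ hS => hS.shortExact) fun S hS c => ?_
    obtain ⟨b, hb⟩ := (leftAdjoint_isRelProjective F Y).exists_lift hS (e.inv ≫ biprod.fst ≫ c)
    exact ⟨biprod.inl ≫ e.hom ≫ b, by simp [hb]⟩

lemma isRelInjective_iff (I : A) : IsRelInjective (SplitBy F) I ↔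
    ∃ (Y : B) (J : A), Nonempty (I ⊞ J ≅ F.rightAdjoint.obj Y) := by
  constructor
  · intro hI
    have hS := splitBy_unit F I
    obtain ⟨b, hb⟩ := hI.exists_extension hS (𝟙 I)
    have s := ShortComplex.Splitting.ofExactOfRetraction _ hS.shortExact.exact b hb
      hS.shortExact.epi_g
    exact ⟨F.obj I, _, ⟨s.isoBinaryBiproduct.symm⟩⟩
  · rintro ⟨Y, J, ⟨e⟩⟩
    refine isRelInjective_of_exists_extension (fun _ hS => hS.shortExact) fun S hS c => ?_
    obtain ⟨b, hb⟩ := (rightAdjoint_isRelInjective F Y).exists_extension hS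
      (c ≫ biprod.inl ≫ e.hom)
    exact ⟨b ≫ e.inv ≫ biprod.fst, by simp [reassoc_of% hb]⟩

end SplitBy

/-! ### The suspension of the stable category -/

section Suspension

variable {C : Type u} [Category.{v} C] [Abelian C] {E : ObjectProperty (ShortComplex C)}

/-- The Frobenius condition: relative projectives and relative injectives coincide. -/
structure IsFrobenius (E : ObjectProperty (ShortComplex C)) : Prop extends IsDetected E where
  projective_iff_injective : ∀ X : C, IsRelProjective E X ↔ IsRelInjective E X

lemma exists_desc {S : ShortComplex C} (hS : S.ShortExact) {T : C} (k : S.X₂ ⟶ T)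
    (hk : S.f ≫ k = 0) : ∃ l : S.X₃ ⟶ T, S.g ≫ l = k := by
  have := hS.epi_g
  exact ⟨hS.exact.desc k hk, hS.exact.g_desc k hk⟩

lemma exists_lift {S : ShortComplex C} (hS : S.ShortExact) {T : C} (k : T ⟶ S.X₂)
    (hk : k ≫ S.g = 0) : ∃ l : T ⟶ S.X₁, l ≫ S.f = k := by
  have := hS.mono_f
  exact ⟨hS.exact.lift k hk, hS.exact.lift_f k hk⟩

/-- The short complex underlying an injective presentation. -/
abbrev InjectivePresentation.complex {X : C} (H : InjectivePresentation E X) : ShortComplex C :=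
  ShortComplex.mk H.ι H.p H.w

lemma InjectivePresentation.complex_mem {X : C} (H : InjectivePresentation E X) : E H.complex :=
  H.mem

lemma toStable_map_eq_zero_iff {X Y : C} (f : X ⟶ Y) :
    (toStable E).map f = 0 ↔
      ∃ (P : C) (a : X ⟶ P) (b : P ⟶ Y), IsRelProjective E P ∧ f = a ≫ b := by
  rw [← (toStable E).map_zero X Y, Quotient.functor_map_eq_iff]
  simp only [stableRel, sub_zero]

lemma exists_toStable_map_eq {X Y : C} (φ : (toStable E).obj X ⟶ (toStable E).obj Y) :
    ∃ f : X ⟶ Y, (toStable E).map f = φ :=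
  (toStable E).map_surjective φ

namespace IsFrobenius

variable (hE : IsFrobenius E)
include hE

lemma map_comp_eq_zero {X I Y : C} (hI : IsRelInjective E I) (a : X ⟶ I) (b : I ⟶ Y) :
    (toStable E).map (a ≫ b) = 0 :=
  (toStable_map_eq_zero_iff _).2 ⟨I, a, b, (hE.projective_iff_injective I).2 hI, rfl⟩

/-- A stably trivial morphism extends along the first map of any sequence in the class, by a stably
trivial morphism. -/
lemma exists_extension_of_map_eq_zero {S : ShortComplex C} (hS : E S) {Y : C} {f : S.X₁ ⟶ Y}
    (hf : (toStable E).map f = 0) : ∃ t : S.X₂ ⟶ Y, S.f ≫ t = f ∧ (toStable E).map t = 0 := by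
  obtain ⟨P, a, b, hP, rfl⟩ := (toStable_map_eq_zero_iff f).1 hf
  have hI := (hE.projective_iff_injective P).1 hP
  obtain ⟨a', rfl⟩ := hI.exists_extension hS a
  exact ⟨a' ≫ b, (Category.assoc _ _ _).symm, hE.map_comp_eq_zero hI a' b⟩

omit hE in
/-- A stably trivial morphism lifts along the second map of any sequence in the class. -/
lemma exists_lift_of_map_eq_zero {S : ShortComplex C} (hS : E S) {Y : C} {f : Y ⟶ S.X₃}
    (hf : (toStable E).map f = 0) : ∃ t : Y ⟶ S.X₂, t ≫ S.g = f := by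
  obtain ⟨P, a, b, hP, rfl⟩ := (toStable_map_eq_zero_iff f).1 hf
  obtain ⟨b', rfl⟩ := hP.exists_lift hS b
  exact ⟨a ≫ b', Category.assoc _ _ _⟩

lemma exists_comparison {S : ShortComplex C} (hS : E S) {Y : C} (K : InjectivePresentation E Y)
    (f : S.X₁ ⟶ Y) : ∃ (a : S.X₂ ⟶ K.I) (b : S.X₃ ⟶ K.Z),
      S.f ≫ a = f ≫ K.ι ∧ S.g ≫ b = a ≫ K.p := by
  obtain ⟨a, ha⟩ := K.injective.exists_extension hS (f ≫ K.ι)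
  obtain ⟨b, hb⟩ := exists_desc (hE.shortExact S hS) (a ≫ K.p)
    (by rw [reassoc_of% ha, K.w, comp_zero])
  exact ⟨a, b, ha, hb⟩

lemma map_eq_zero_of_comparison {S : ShortComplex C} (hS : E S) {Y : C}
    (K : InjectivePresentation E Y) {f : S.X₁ ⟶ Y} {a : S.X₂ ⟶ K.I} {b : S.X₃ ⟶ K.Z}
    (hf : (toStable E).map f = 0) (ha : S.f ≫ a = f ≫ K.ι) (hb : S.g ≫ b = a ≫ K.p) :
    (toStable E).map b = 0 := by
  obtain ⟨t, rfl, -⟩ := hE.exists_extension_of_map_eq_zero hS hf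
  obtain ⟨s, hs⟩ := exists_desc (hE.shortExact S hS) (a - t ≫ K.ι) (by simp [ha])
  have : b = s ≫ K.p := by
    have := (hE.shortExact S hS).epi_g
    rw [← cancel_epi S.g, hb, reassoc_of% hs, Preadditive.sub_comp, Category.assoc, K.w,
      comp_zero, sub_zero]
  rw [this]
  exact hE.map_comp_eq_zero K.injective s K.p

/-- The stable class of the map induced on third terms by an extension of `f : S.X₁ ⟶ Y` to a
morphism from a sequence `S` in the class to an injective presentation of `Y`. -/
noncomputable def connecting {S : ShortComplex C} (hS : E S) {Y : C}
    (K : InjectivePresentation E Y) (f : S.X₁ ⟶ Y) :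
    (toStable E).obj S.X₃ ⟶ (toStable E).obj K.Z :=
  (toStable E).map (hE.exists_comparison hS K f).choose_spec.choose

/-- The class `connecting` only depends on the stable class of `f`, and can be computed with any
choice of the extension. -/
lemma connecting_eq {S : ShortComplex C} (hS : E S) {Y : C} (K : InjectivePresentation E Y)
    {f f' : S.X₁ ⟶ Y} {a : S.X₂ ⟶ K.I} {b : S.X₃ ⟶ K.Z}
    (ha : S.f ≫ a = f ≫ K.ι) (hb : S.g ≫ b = a ≫ K.p)
    (hf : (toStable E).map f = (toStable E).map f') :
    hE.connecting hS K f' = (toStable E).map b := by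
  obtain ⟨ha', hb'⟩ := (hE.exists_comparison hS K f').choose_spec.choose_spec
  refine (sub_eq_zero.1 ?_).symm
  rw [connecting, ← Functor.map_sub]
  refine hE.map_eq_zero_of_comparison hS K (f := f - f') ?_ ?_
    (by rw [Preadditive.comp_sub, hb, hb', ← Preadditive.sub_comp])
  · rw [Functor.map_sub, hf, sub_self]
  · rw [Preadditive.comp_sub, ha, ha', ← Preadditive.sub_comp]

lemma connecting_comp {S : ShortComplex C} (hS : E S) {Y W : C} (K : InjectivePresentation E Y)
    (M : InjectivePresentation E W) (f : S.X₁ ⟶ Y) (g : Y ⟶ W) :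
    hE.connecting hS K f ≫ hE.connecting K.complex_mem M g =
      hE.connecting hS M (f ≫ g) := by
  obtain ⟨a, b, ha, hb⟩ := hE.exists_comparison hS K f
  obtain ⟨a', b', ha', hb'⟩ := hE.exists_comparison K.complex_mem M g
  dsimp at a' b' ha' hb'
  rw [hE.connecting_eq hS K ha hb rfl, hE.connecting_eq K.complex_mem M ha' hb' rfl,
    hE.connecting_eq hS M (a := a ≫ a') (b := b ≫ b')
      (by rw [reassoc_of% ha, ha', Category.assoc])
      (by rw [reassoc_of% hb, hb', Category.assoc]) rfl, Functor.map_comp]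

lemma map_comp_connecting {S T : ShortComplex C} (hS : E S) (hT : E T) (τ : S ⟶ T) {Y : C}
    (K : InjectivePresentation E Y) (f : T.X₁ ⟶ Y) :
    (toStable E).map τ.τ₃ ≫ hE.connecting hT K f = hE.connecting hS K (τ.τ₁ ≫ f) := by
  obtain ⟨a, b, ha, hb⟩ := hE.exists_comparison hT K f
  rw [hE.connecting_eq hT K ha hb rfl,
    hE.connecting_eq hS K (a := τ.τ₂ ≫ a) (b := τ.τ₃ ≫ b)
      (by rw [← τ.comm₁₂_assoc, ha, Category.assoc])
      (by rw [← τ.comm₂₃_assoc, hb, Category.assoc]) rfl, Functor.map_comp]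

lemma connecting_id {X : C} (K : InjectivePresentation E X) :
    hE.connecting K.complex_mem K (𝟙 X) = 𝟙 _ := by
  rw [hE.connecting_eq K.complex_mem K (f := 𝟙 X) (a := 𝟙 _) (b := 𝟙 _)
    ((Category.comp_id _).trans (Category.id_comp _).symm)
    ((Category.comp_id _).trans (Category.id_comp _).symm) rfl]
  exact (toStable E).map_id _

/-- Two injective presentations of an object have stably isomorphic cokernels. -/
noncomputable def presentationIso {X : C} (H K : InjectivePresentation E X) :
    (toStable E).obj H.Z ≅ (toStable E).obj K.Z where
  hom := hE.connecting H.complex_mem K (𝟙 X)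
  inv := hE.connecting K.complex_mem H (𝟙 X)
  hom_inv_id := by
    refine (hE.connecting_comp H.complex_mem K H (𝟙 X) (𝟙 X)).trans ?_
    rw [Category.id_comp]
    exact hE.connecting_id H
  inv_hom_id := by
    refine (hE.connecting_comp K.complex_mem H K (𝟙 X) (𝟙 X)).trans ?_
    rw [Category.id_comp]
    exact hE.connecting_id K

/-- A choice of an injective presentation of each object. -/
noncomputable def presentation (X : C) : InjectivePresentation E X :=
  (hE.enoughInjectives X).some

/-- The suspension: it sends `X` to the cokernel of a chosen inflation into an injective. -/
noncomputable def suspension : StableCategory E ⥤ StableCategory E :=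
  CategoryTheory.Quotient.lift (stableRel E)
    { obj := fun X => (toStable E).obj (hE.presentation X).Z
      map := fun {X Y} f =>
        hE.connecting (hE.presentation X).complex_mem
          (hE.presentation Y) f
      map_id := fun X => hE.connecting_id _
      map_comp := fun {X Y Z} f g => (hE.connecting_comp (hE.presentation X).complex_mem
        (hE.presentation Y) (hE.presentation Z) f g).symm }
    (fun X Y f g hfg => by
      obtain ⟨a, b, ha, hb⟩ := hE.exists_comparison (hE.presentation X).complex_mem
        (hE.presentation Y) f
      have h := (Quotient.functor_map_eq_iff (stableRel E) f g).2 hfg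
      exact (hE.connecting_eq (hE.presentation X).complex_mem _
          ha hb rfl).trans
        (hE.connecting_eq (hE.presentation X).complex_mem _
          ha hb h).symm)

lemma suspension_map {X Y : C} (f : X ⟶ Y) :
    hE.suspension.map ((toStable E).map f) =
      hE.connecting (hE.presentation X).complex_mem
        (hE.presentation Y) f := rfl

lemma suspension_additive : hE.suspension.Additive where
  map_add {X Y f g} := by
    obtain ⟨X⟩ := X
    obtain ⟨Y⟩ := Y
    obtain ⟨f, rfl⟩ := exists_toStable_map_eq (E := E) (X := X) (Y := Y) f
    obtain ⟨g, rfl⟩ := exists_toStable_map_eq (E := E) (X := X) (Y := Y) g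
    rw [← Functor.map_add, suspension_map, suspension_map, suspension_map]
    obtain ⟨a, b, ha, hb⟩ := hE.exists_comparison (hE.presentation X).complex_mem
      (hE.presentation Y) f
    obtain ⟨a', b', ha', hb'⟩ := hE.exists_comparison (hE.presentation X).complex_mem
      (hE.presentation Y) g
    rw [hE.connecting_eq (hE.presentation X).complex_mem _ ha hb rfl,
      hE.connecting_eq (hE.presentation X).complex_mem _ ha' hb' rfl,
      hE.connecting_eq (hE.presentation X).complex_mem _ (a := a + a') (b := b + b')
        (by rw [Preadditive.comp_add, ha, ha', ← Preadditive.add_comp])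
        (by rw [Preadditive.comp_add, hb, hb', ← Preadditive.add_comp]) rfl]
    exact Functor.map_add _

lemma suspension_full : hE.suspension.Full where
  map_surjective {X Y} φ := by
    obtain ⟨X⟩ := X
    obtain ⟨Y⟩ := Y
    let H := hE.presentation X
    let K := hE.presentation Y
    obtain ⟨h, rfl⟩ := exists_toStable_map_eq (E := E) (X := H.Z) (Y := K.Z) φ
    -- The injective middle term is projective, so the morphism of cokernels lifts to middle terms.
    obtain ⟨g, hg⟩ := ((hE.projective_iff_injective H.I).2 H.injective).exists_lift
      K.complex_mem (H.p ≫ h)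
    obtain ⟨f, hf⟩ := exists_lift (hE.shortExact _ K.complex_mem) (H.ι ≫ g)
      (by
        have hg' : g ≫ K.p = H.p ≫ h := hg
        dsimp
        rw [Category.assoc, hg', reassoc_of% H.w, zero_comp])
    exact ⟨(toStable E).map f,
      hE.connecting_eq H.complex_mem K hf.symm hg.symm rfl⟩

lemma suspension_faithful : hE.suspension.Faithful where
  map_injective {X Y φ ψ} hφψ := by
    have := hE.suspension_additive
    rw [← sub_eq_zero, ← Functor.map_sub] at hφψ
    rw [← sub_eq_zero]
    obtain ⟨X⟩ := X
    obtain ⟨Y⟩ := Y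
    obtain ⟨f, hf⟩ := exists_toStable_map_eq (E := E) (X := X) (Y := Y) (φ - ψ)
    rw [← hf] at hφψ ⊢
    let H := hE.presentation X
    let K := hE.presentation Y
    obtain ⟨g, h, hg, hh⟩ := hE.exists_comparison H.complex_mem K f
    have h0 : (toStable E).map h = 0 :=
      (hE.connecting_eq H.complex_mem K hg hh rfl).symm.trans hφψ
    obtain ⟨t, ht⟩ := exists_lift_of_map_eq_zero K.complex_mem h0
    dsimp at g h hg hh t ht
    obtain ⟨s, hs⟩ := exists_lift (hE.shortExact _ K.complex_mem) (g - H.p ≫ t) (by simp [ht, hh])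
    dsimp at s hs
    have hfs : f = H.ι ≫ s := by
      have : Mono K.ι := (hE.shortExact _ K.complex_mem).mono_f
      rw [← cancel_mono K.ι, Category.assoc, hs, Preadditive.comp_sub, ← hg, reassoc_of% H.w,
        zero_comp, sub_zero]
    rw [hfs]
    exact hE.map_comp_eq_zero H.injective _ _

lemma suspension_essSurj : hE.suspension.EssSurj where
  mem_essImage Z := by
    obtain ⟨Z⟩ := Z
    -- A projective presentation of `Z` is an injective presentation of its kernel.
    obtain ⟨X, P, i, p, w, hS, hP⟩ := hE.enoughProjectives Z
    let K : InjectivePresentation E X :=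
      ⟨P, Z, i, p, w, hS, (hE.projective_iff_injective P).1 hP⟩
    exact ⟨(toStable E).obj X, ⟨hE.presentationIso (hE.presentation X) K⟩⟩

lemma suspension_isEquivalence : hE.suspension.IsEquivalence :=
  have := hE.suspension_full
  have := hE.suspension_faithful
  have := hE.suspension_essSurj
  { }

/-- Any injective presentation of `X` computes the suspension of `X`. -/
noncomputable def suspensionIso (X : C) (H : InjectivePresentation E X) :
    hE.suspension.obj ((toStable E).obj X) ≅ (toStable E).obj H.Z :=
  hE.presentationIso (hE.presentation X) H

lemma suspensionIso_naturality {X Y : C} (f : X ⟶ Y) (H : InjectivePresentation E X)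
    (K : InjectivePresentation E Y) {g : H.I ⟶ K.I} {h : H.Z ⟶ K.Z}
    (hg : H.ι ≫ g = f ≫ K.ι) (hh : H.p ≫ h = g ≫ K.p) :
    hE.suspension.map ((toStable E).map f) ≫ (hE.suspensionIso Y K).hom =
      (hE.suspensionIso X H).hom ≫ (toStable E).map h := by
  rw [← hE.connecting_eq H.complex_mem K hg hh rfl]
  refine (hE.connecting_comp (hE.presentation X).complex_mem _ K f (𝟙 Y)).trans ?_
  refine Eq.trans ?_ (hE.connecting_comp (hE.presentation X).complex_mem H K (𝟙 X) f).symm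
  rw [Category.comp_id, Category.id_comp]

/-- A shift on the stable category extending the suspension, with its identification on all
injective presentations. -/
theorem exists_shift : ∃ (_ : HasShift (StableCategory E) ℤ)
    (_ : ∀ n : ℤ, (shiftFunctor (StableCategory E) n).Additive)
    (e : ∀ (X : C) (H : InjectivePresentation E X),
      (shiftFunctor (StableCategory E) (1 : ℤ)).obj ((toStable E).obj X) ≅ (toStable E).obj H.Z),
    ∀ (X Y : C) (f : X ⟶ Y) (H : InjectivePresentation E X) (K : InjectivePresentation E Y)
      (g : H.I ⟶ K.I) (h : H.Z ⟶ K.Z), H.ι ≫ g = f ≫ K.ι → H.p ≫ h = g ≫ K.p →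
      (shiftFunctor (StableCategory E) (1 : ℤ)).map ((toStable E).map f) ≫ (e Y K).hom =
        (e X H).hom ≫ (toStable E).map h := by
  have := hE.suspension_isEquivalence
  obtain ⟨sh, ⟨α⟩⟩ := exists_hasShift_of_isEquivalence hE.suspension
  have := hE.suspension_additive
  have := Functor.additive_of_iso α.symm
  refine ⟨sh, fun n => shiftFunctor_additive n,
    fun X H => α.app ((toStable E).obj X) ≪≫ hE.suspensionIso X H, ?_⟩
  intro X Y f H K g h hg hh
  dsimp only
  rw [Iso.trans_hom, Iso.trans_hom, Category.assoc, ← hE.suspensionIso_naturality f H K hg hh,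
    Iso.app_hom, Iso.app_hom, α.hom.naturality_assoc]

end IsFrobenius

end Suspension

/-! ### Distinguished triangles of the stable category -/

section Triangles

open Pretriangulated

variable {C : Type u} [Category.{v} C] [Abelian C] {E : ObjectProperty (ShortComplex C)}

variable (E) in
/-- Identifications of the shift by one with the cokernels of injective presentations, natural with
respect to morphisms of presentations. -/
structure ShiftComparison [HasShift (StableCategory E) ℤ] where
  iso : ∀ (X : C) (H : InjectivePresentation E X),
    ((toStable E).obj X)⟦(1 : ℤ)⟧ ≅ (toStable E).obj H.Z
  naturality : ∀ (X Y : C) (f : X ⟶ Y) (H : InjectivePresentation E X)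
    (K : InjectivePresentation E Y) (g : H.I ⟶ K.I) (h : H.Z ⟶ K.Z),
    H.ι ≫ g = f ≫ K.ι → H.p ≫ h = g ≫ K.p →
    ((toStable E).map f)⟦(1 : ℤ)⟧' ≫ (iso Y K).hom = (iso X H).hom ≫ (toStable E).map h

namespace IsFrobenius

variable (hE : IsFrobenius E)
include hE

lemma mem_of_exists_desc {S : ShortComplex C} [Epi S.g]
    (hd : ∀ {T : C} (k : S.X₂ ⟶ T), S.f ≫ k = 0 → ∃ l : S.X₃ ⟶ T, S.g ≫ l = k)
    (h : ∀ I, IsRelInjective E I → ∀ c : S.X₁ ⟶ I, ∃ b : S.X₂ ⟶ I, S.f ≫ b = c) : E S :=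
  hE.mem_of_isColimit S (CokernelCofork.IsColimit.ofπ' S.g S.zero
    fun k hk => ⟨(hd k hk).choose, (hd k hk).choose_spec⟩) h

lemma mem_of_exists_lift {S : ShortComplex C} [Mono S.f]
    (hl : ∀ {T : C} (k : T ⟶ S.X₂), k ≫ S.g = 0 → ∃ l : T ⟶ S.X₁, l ≫ S.f = k)
    (h : ∀ P, IsRelProjective E P → ∀ c : P ⟶ S.X₃, ∃ b : P ⟶ S.X₂, b ≫ S.g = c) : E S :=
  hE.mem_of_isLimit S (KernelFork.IsLimit.ofι' S.f S.zero
    fun k hk => ⟨(hl k hk).choose, (hl k hk).choose_spec⟩) h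

/-- An injective summand is invisible in the stable category. -/
@[simps]
noncomputable def biprodIso (X : C) {I : C} (hI : IsRelInjective E I) :
    (toStable E).obj (X ⊞ I) ≅ (toStable E).obj X where
  hom := (toStable E).map biprod.fst
  inv := (toStable E).map biprod.inl
  hom_inv_id := by
    rw [← Functor.map_comp, ← sub_eq_zero, ← CategoryTheory.Functor.map_id, ← Functor.map_sub]
    have : (biprod.fst ≫ biprod.inl - 𝟙 (X ⊞ I) : X ⊞ I ⟶ X ⊞ I) =
        -(biprod.snd ≫ biprod.inr) := by
      rw [← biprod.total]
      abel
    rw [this, Functor.map_neg, hE.map_comp_eq_zero hI, neg_zero]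
  inv_hom_id := by
    rw [← Functor.map_comp, biprod.inl_fst, CategoryTheory.Functor.map_id]

/-- Every morphism becomes an inflation after adding an injective summand to its target. -/
lemma cokernel_lift_mem {X Y : C} (f : X ⟶ Y) (H : InjectivePresentation E X) :
    E (ShortComplex.mk (biprod.lift f H.ι) (cokernel.π (biprod.lift f H.ι))
      (cokernel.condition _)) := by
  refine hE.cokernel_mem _ fun J hJ c => ?_
  obtain ⟨t, ht⟩ := hJ.exists_extension H.complex_mem c
  exact ⟨biprod.snd ≫ t, by simpa using ht⟩

variable [HasShift (StableCategory E) ℤ] (c : ShiftComparison E)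

omit hE in
lemma naturality_inv {X Y : C} (f : X ⟶ Y) (H : InjectivePresentation E X)
    (K : InjectivePresentation E Y) {g : H.I ⟶ K.I} {h : H.Z ⟶ K.Z}
    (hg : H.ι ≫ g = f ≫ K.ι) (hh : H.p ≫ h = g ≫ K.p) :
    (c.iso X H).inv ≫ ((toStable E).map f)⟦(1 : ℤ)⟧' =
      (toStable E).map h ≫ (c.iso Y K).inv := by
  rw [Iso.inv_comp_eq, ← Category.assoc, Iso.eq_comp_inv]
  exact c.naturality X Y f H K g h hg hh

/-- The connecting morphism `Z ⟶ X⟦1⟧` of a sequence `X ⟶ Y ⟶ Z` in the class. -/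
noncomputable def boundary {S : ShortComplex C} (hS : E S) :
    (toStable E).obj S.X₃ ⟶ ((toStable E).obj S.X₁)⟦(1 : ℤ)⟧ :=
  hE.connecting hS (hE.presentation S.X₁) (𝟙 _) ≫ (c.iso S.X₁ (hE.presentation S.X₁)).inv

lemma connecting_comp_inv {S : ShortComplex C} (hS : E S) {Y : C} (f : S.X₁ ⟶ Y)
    (H : InjectivePresentation E S.X₁) (K : InjectivePresentation E Y) :
    hE.connecting hS H (𝟙 _) ≫ (c.iso S.X₁ H).inv ≫ ((toStable E).map f)⟦(1 : ℤ)⟧' =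
      hE.connecting hS K f ≫ (c.iso Y K).inv := by
  obtain ⟨g, h, hg, hh⟩ := hE.exists_comparison H.complex_mem K f
  rw [naturality_inv c f H K hg hh, ← hE.connecting_eq H.complex_mem K hg hh rfl,
    ← Category.assoc, hE.connecting_comp hS H K, Category.id_comp]

/-- The connecting morphism can be computed with any injective presentation. -/
lemma boundary_eq {S : ShortComplex C} (hS : E S) (H : InjectivePresentation E S.X₁)
    {a : S.X₂ ⟶ H.I} {b : S.X₃ ⟶ H.Z} (ha : S.f ≫ a = H.ι) (hb : S.g ≫ b = a ≫ H.p) :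
    hE.boundary c hS = (toStable E).map b ≫ (c.iso S.X₁ H).inv := by
  have h := hE.connecting_comp_inv c hS (𝟙 _) (hE.presentation S.X₁) H
  rw [CategoryTheory.Functor.map_id, CategoryTheory.Functor.map_id, Category.comp_id] at h
  rw [boundary, h, hE.connecting_eq hS H (f := 𝟙 _) (by rw [ha, Category.id_comp]) hb rfl]

lemma boundary_naturality {S T : ShortComplex C} (hS : E S) (hT : E T) (τ : S ⟶ T) :
    hE.boundary c hS ≫ ((toStable E).map τ.τ₁)⟦(1 : ℤ)⟧' =
      (toStable E).map τ.τ₃ ≫ hE.boundary c hT := by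
  rw [boundary, Category.assoc, hE.connecting_comp_inv c hS τ.τ₁ _ (hE.presentation T.X₁),
    boundary, ← Category.assoc, hE.map_comp_connecting hS hT τ, Category.comp_id]

/-- The triangle of a sequence in the class. -/
noncomputable abbrev triangle {S : ShortComplex C} (hS : E S) : Triangle (StableCategory E) :=
  Triangle.mk ((toStable E).map S.f) ((toStable E).map S.g) (hE.boundary c hS)

/-- The triangles isomorphic to the triangle of a sequence in the class. -/
def triangles : Set (Triangle (StableCategory E)) :=
  {T | ∃ (S : ShortComplex C) (hS : E S), Nonempty (T ≅ hE.triangle c hS)}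

lemma triangle_mem {S : ShortComplex C} (hS : E S) : hE.triangle c hS ∈ hE.triangles c :=
  ⟨S, hS, ⟨Iso.refl _⟩⟩

lemma mem_triangles_of_iso {T T' : Triangle (StableCategory E)} (e : T ≅ T')
    (hT' : T' ∈ hE.triangles c) : T ∈ hE.triangles c := by
  obtain ⟨S, hS, ⟨e'⟩⟩ := hT'
  exact ⟨S, hS, ⟨e ≪≫ e'⟩⟩

lemma contractibleTriangle_mem (X : StableCategory E) :
    contractibleTriangle X ∈ hE.triangles c := by
  obtain ⟨X⟩ := X
  have hS := hE.cokernel_mem (𝟙 X) fun _ _ k => ⟨k, Category.id_comp k⟩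
  have hZ : IsZero ((toStable E).obj (cokernel (𝟙 X))) :=
    (toStable E).map_isZero (isZero_cokernel_of_epi (𝟙 X))
  refine ⟨_, hS, ⟨Triangle.isoMk _ _ (Iso.refl _) (Iso.refl _) ((isZero_zero _).iso hZ) ?_
    (hZ.eq_of_tgt _ _) ((isZero_zero _).eq_of_src _ _)⟩⟩
  exact congrArg (· ≫ 𝟙 _) ((toStable E).map_id X).symm

/-- Up to isomorphism, every morphism is the first map of a sequence in the class. -/
lemma exists_triangle {X Y : StableCategory E} (φ : X ⟶ Y) :
    ∃ (Z : StableCategory E) (ψ : Y ⟶ Z) (δ : Z ⟶ X⟦(1 : ℤ)⟧),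
      Triangle.mk φ ψ δ ∈ hE.triangles c := by
  obtain ⟨X⟩ := X
  obtain ⟨Y⟩ := Y
  obtain ⟨f, rfl⟩ := exists_toStable_map_eq (E := E) (X := X) (Y := Y) φ
  let H := hE.presentation X
  have hS := hE.cokernel_lift_mem f H
  refine ⟨_, (hE.biprodIso Y H.injective).inv ≫ (toStable E).map (cokernel.π (biprod.lift f H.ι)),
    hE.boundary c hS, _, hS, ⟨Triangle.isoMk _ _ (Iso.refl _) (hE.biprodIso Y H.injective).symm
      (Iso.refl _) ?_ ?_ ?_⟩⟩
  · dsimp only [Triangle.mk, triangle, Iso.symm_hom, Iso.refl_hom]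
    rw [Iso.comp_inv_eq, biprodIso_hom, Category.id_comp, ← Functor.map_comp, biprod.lift_fst]
  · exact Category.comp_id _
  · dsimp only [Triangle.mk, triangle, Iso.refl_hom]
    rw [CategoryTheory.Functor.map_id, Category.comp_id, Category.id_comp]

omit [HasShift (StableCategory E) ℤ] in
/-- A commutative square between the first maps of two triangles can be modified within the stable
classes so as to commute strictly, because stably trivial morphisms extend along inflations. -/
lemma exists_shortComplex_hom {S T : ShortComplex C} (hS : E S)
    (α : (toStable E).obj S.X₁ ⟶ (toStable E).obj T.X₁)
    (β : (toStable E).obj S.X₂ ⟶ (toStable E).obj T.X₂)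
    (h : (toStable E).map S.f ≫ β = α ≫ (toStable E).map T.f) :
    ∃ τ : S ⟶ T, (toStable E).map τ.τ₁ = α ∧ (toStable E).map τ.τ₂ = β := by
  obtain ⟨a, rfl⟩ := exists_toStable_map_eq α
  obtain ⟨b, rfl⟩ := exists_toStable_map_eq β
  obtain ⟨t, ht, ht0⟩ := hE.exists_extension_of_map_eq_zero hS (f := S.f ≫ b - a ≫ T.f)
    (by rw [Functor.map_sub, Functor.map_comp, Functor.map_comp, h, sub_self])
  have comm : a ≫ T.f = S.f ≫ (b - t) := by
    rw [Preadditive.comp_sub, ht]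
    abel
  obtain ⟨d, hd⟩ := exists_desc (hE.shortExact S hS) ((b - t) ≫ T.g)
    (by rw [← Category.assoc, ← comm, Category.assoc, T.zero, comp_zero])
  exact ⟨{ τ₁ := a, τ₂ := b - t, τ₃ := d, comm₁₂ := comm, comm₂₃ := hd.symm }, rfl,
    by rw [Functor.map_sub, ht0, sub_zero]⟩

lemma exists_triangle_hom_of_shortComplex {S T : ShortComplex C} (hS : E S) (hT : E T)
    (α : (hE.triangle c hS).obj₁ ⟶ (hE.triangle c hT).obj₁)
    (β : (hE.triangle c hS).obj₂ ⟶ (hE.triangle c hT).obj₂)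
    (h : (hE.triangle c hS).mor₁ ≫ β = α ≫ (hE.triangle c hT).mor₁) :
    ∃ m : hE.triangle c hS ⟶ hE.triangle c hT, m.hom₁ = α ∧ m.hom₂ = β := by
  obtain ⟨τ, rfl, rfl⟩ := hE.exists_shortComplex_hom hS α β h
  have h₂ : (toStable E).map S.g ≫ (toStable E).map τ.τ₃ =
      (toStable E).map τ.τ₂ ≫ (toStable E).map T.g := by
    rw [← Functor.map_comp, ← Functor.map_comp, τ.comm₂₃]
  exact ⟨Triangle.homMk _ _ _ _ ((toStable E).map τ.τ₃) h h₂
    (hE.boundary_naturality c hS hT τ), rfl, rfl⟩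

lemma exists_triangle_hom (T₁ T₂ : Triangle (StableCategory E)) (h₁ : T₁ ∈ hE.triangles c)
    (h₂ : T₂ ∈ hE.triangles c) (a : T₁.obj₁ ⟶ T₂.obj₁) (b : T₁.obj₂ ⟶ T₂.obj₂)
    (hab : T₁.mor₁ ≫ b = a ≫ T₂.mor₁) :
    ∃ d : T₁.obj₃ ⟶ T₂.obj₃, T₁.mor₂ ≫ d = b ≫ T₂.mor₂ ∧
      T₁.mor₃ ≫ a⟦(1 : ℤ)⟧' = d ≫ T₂.mor₃ := by
  obtain ⟨S₁, hS₁, ⟨e₁⟩⟩ := h₁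
  obtain ⟨S₂, hS₂, ⟨e₂⟩⟩ := h₂
  obtain ⟨m, hm₁, hm₂⟩ := hE.exists_triangle_hom_of_shortComplex c hS₁ hS₂
    (e₁.inv.hom₁ ≫ a ≫ e₂.hom.hom₁) (e₁.inv.hom₂ ≫ b ≫ e₂.hom.hom₂)
    (by rw [e₁.inv.comm₁_assoc, reassoc_of% hab, e₂.hom.comm₁, Category.assoc, Category.assoc])
  have hn₁ : (e₁.hom ≫ m ≫ e₂.inv).hom₁ = a := by
    rw [comp_hom₁, comp_hom₁, hm₁]
    simp
  have hn₂ : (e₁.hom ≫ m ≫ e₂.inv).hom₂ = b := by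
    rw [comp_hom₂, comp_hom₂, hm₂]
    simp
  refine ⟨(e₁.hom ≫ m ≫ e₂.inv).hom₃, ?_, ?_⟩
  · rw [← hn₂]
    exact (e₁.hom ≫ m ≫ e₂.inv).comm₂
  · rw [← hn₁]
    exact (e₁.hom ≫ m ≫ e₂.inv).comm₃

end IsFrobenius

end Triangles

/-! ### Rotation of triangles -/

section Rotation

open Pretriangulated

variable {C : Type u} [Category.{v} C] [Abelian C] {E : ObjectProperty (ShortComplex C)}

namespace IsFrobenius

variable (hE : IsFrobenius E)
include hE

/-- If a sequence `X ⟶ Y ⟶ Z` maps by `(𝟙, a, b)` to an injective presentation `X ⟶ I ⟶ X'`, then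
the square `Y, Z, I, X'` is bicartesian and gives a sequence `Y ⟶ Z ⊞ I ⟶ X'`. -/
lemma rotated_mem {S : ShortComplex C} (hS : E S) (H : InjectivePresentation E S.X₁)
    {a : S.X₂ ⟶ H.I} {b : S.X₃ ⟶ H.Z} (ha : S.f ≫ a = H.ι) (hb : S.g ≫ b = a ≫ H.p) :
    E (ShortComplex.mk (biprod.lift S.g a) (biprod.desc b (-H.p)) (by simp [hb])) := by
  have hHe := hE.shortExact _ H.complex_mem
  have hSe := hE.shortExact _ hS
  have : Epi S.g := hSe.epi_g
  have : Epi H.p := hHe.epi_g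
  have : Epi (biprod.desc b (-H.p)) :=
    epi_of_epi_fac (show (-biprod.inr) ≫ biprod.desc b (-H.p) = H.p by simp)
  refine hE.mem_of_exists_desc (S := ShortComplex.mk _ _ _) ?_ ?_
  · intro T k hk
    obtain ⟨k₁, k₂, rfl⟩ : ∃ k₁ k₂, k = biprod.desc k₁ k₂ :=
      ⟨biprod.inl ≫ k, biprod.inr ≫ k, by ext <;> simp⟩
    dsimp at hk
    rw [biprod.lift_desc] at hk
    obtain ⟨l, hl⟩ := exists_desc hHe k₂ (by
      have : S.f ≫ (S.g ≫ k₁ + a ≫ k₂) = S.f ≫ 0 := by rw [hk]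
      rwa [Preadditive.comp_add, S.zero_assoc, zero_comp, zero_add, reassoc_of% ha,
        comp_zero] at this)
    dsimp at l hl
    refine ⟨-l, ?_⟩
    dsimp
    ext
    · rw [biprod.inl_desc_assoc, biprod.inl_desc, ← cancel_epi S.g, eq_neg_of_add_eq_zero_left hk,
        Preadditive.comp_neg, Preadditive.comp_neg, reassoc_of% hb, hl]
    · rw [biprod.inr_desc_assoc, biprod.inr_desc, Preadditive.neg_comp, Preadditive.comp_neg,
        neg_neg, hl]
  · intro J hJ x
    obtain ⟨t, ht⟩ := hJ.exists_extension H.complex_mem (S.f ≫ x)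
    dsimp at x t ht
    obtain ⟨s, hs⟩ := exists_desc hSe (x - a ≫ t) (by
      rw [Preadditive.comp_sub, reassoc_of% ha, ht, sub_self])
    exact ⟨biprod.desc s t, by
      dsimp
      rw [biprod.lift_desc, hs, sub_add_cancel]⟩

/-- Given a sequence `Y ⟶ Z ⟶ W`, a sequence `Q ⟶ P ⟶ W` with `P` projective, and a lift of
`P ⟶ W` to `P ⟶ Z`, the square `Q, Y, P, Z` is bicartesian and gives a sequence
`Q ⟶ Y ⊞ P ⟶ Z`. -/
lemma invRotated_mem {S : ShortComplex C} (hS : E S) {Q P : C} {i : Q ⟶ P} {q : P ⟶ S.X₃}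
    (w : i ≫ q = 0) (hT : E (ShortComplex.mk i q w)) {k : P ⟶ S.X₂} {d : Q ⟶ S.X₁}
    (hk : k ≫ S.g = q) (hd : d ≫ S.f = i ≫ k) :
    E (ShortComplex.mk (biprod.lift d i) (biprod.desc (-S.f) k) (by simp [hd])) := by
  have hTe := hE.shortExact _ hT
  have hSe := hE.shortExact _ hS
  have : Mono S.f := hSe.mono_f
  have : Mono i := hTe.mono_f
  have : Mono (biprod.lift d i) :=
    mono_of_mono_fac (show biprod.lift d i ≫ biprod.snd = i by simp)
  refine hE.mem_of_exists_lift (S := ShortComplex.mk _ _ _) ?_ ?_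
  · intro T y hy
    obtain ⟨y₁, y₂, rfl⟩ : ∃ y₁ y₂, y = biprod.lift y₁ y₂ :=
      ⟨y ≫ biprod.fst, y ≫ biprod.snd, by ext <;> simp⟩
    dsimp at hy
    rw [biprod.lift_desc, Preadditive.comp_neg, neg_add_eq_zero] at hy
    obtain ⟨l, hl⟩ := exists_lift hTe y₂ (by
      change y₂ ≫ q = 0
      rw [← hk, ← Category.assoc, ← hy, Category.assoc, S.zero, comp_zero])
    dsimp at l hl
    refine ⟨l, ?_⟩
    dsimp
    ext
    · rw [Category.assoc, biprod.lift_fst, biprod.lift_fst, ← cancel_mono S.f, Category.assoc, hd,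
        reassoc_of% hl, hy]
    · rw [Category.assoc, biprod.lift_snd, biprod.lift_snd, hl]
  · intro R hR x
    dsimp at x
    obtain ⟨y, hy⟩ := hR.exists_lift hT (x ≫ S.g)
    dsimp at y hy
    obtain ⟨z, hz⟩ := exists_lift hSe (x - y ≫ k) (by
      rw [Preadditive.sub_comp, Category.assoc, hk, hy, sub_self])
    exact ⟨biprod.lift (-z) y, by
      dsimp
      rw [biprod.lift_desc, Preadditive.neg_comp, Preadditive.comp_neg, neg_neg, hz,
        sub_add_cancel]⟩

variable [HasShift (StableCategory E) ℤ] [∀ n : ℤ, (shiftFunctor (StableCategory E) n).Additive]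
  (c : ShiftComparison E)

omit [∀ n : ℤ, (shiftFunctor (StableCategory E) n).Additive] in
lemma rotate_triangle_mem {S : ShortComplex C} (hS : E S) :
    (hE.triangle c hS).rotate ∈ hE.triangles c := by
  let H := hE.presentation S.X₁
  let K := hE.presentation S.X₂
  obtain ⟨a, b, ha, hb⟩ := hE.exists_comparison hS H (𝟙 _)
  rw [Category.id_comp] at ha
  obtain ⟨g, h, hg, hh⟩ := hE.exists_comparison H.complex_mem K S.f
  dsimp at g h hg hh
  have hR := hE.rotated_mem hS H ha hb
  obtain ⟨s, hs⟩ := exists_desc (hE.shortExact _ hS) (K.ι - a ≫ g) (by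
    rw [Preadditive.comp_sub, reassoc_of% ha, hg, sub_self])
  have : Epi S.g := (hE.shortExact _ hS).epi_g
  have hδ : hE.boundary c hR = (toStable E).map (-h) ≫ (c.iso S.X₂ K).inv := by
    refine hE.boundary_eq c hR K (a := biprod.desc s g) ?_ ?_
    · dsimp
      rw [biprod.lift_desc, hs, sub_add_cancel]
    · dsimp
      ext
      · rw [biprod.inl_desc_assoc, biprod.inl_desc_assoc, ← cancel_epi S.g, reassoc_of% hb,
          reassoc_of% hs, Preadditive.sub_comp, K.w, zero_sub, Category.assoc, ← hh,
          Preadditive.comp_neg, Preadditive.comp_neg]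
      · rw [biprod.inr_desc_assoc, biprod.inr_desc_assoc, Preadditive.neg_comp,
          Preadditive.comp_neg, neg_neg, hh]
  refine ⟨_, hR, ⟨Triangle.isoMk _ _ (Iso.refl _) (hE.biprodIso S.X₃ H.injective).symm
    (c.iso S.X₁ H) ?_ ?_ ?_⟩⟩
  · change (toStable E).map S.g ≫ (hE.biprodIso S.X₃ H.injective).inv =
      𝟙 _ ≫ (toStable E).map (biprod.lift S.g a)
    rw [Iso.comp_inv_eq, Category.id_comp, biprodIso_hom, ← Functor.map_comp, biprod.lift_fst]
  · change hE.boundary c hS ≫ (c.iso S.X₁ H).hom =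
      (toStable E).map biprod.inl ≫ (toStable E).map (biprod.desc b (-H.p))
    rw [hE.boundary_eq c hS H ha hb, Category.assoc, Iso.inv_hom_id, Category.comp_id,
      ← Functor.map_comp, biprod.inl_desc]
  · change (-((toStable E).map S.f)⟦(1 : ℤ)⟧') ≫ (𝟙 ((toStable E).obj S.X₂))⟦(1 : ℤ)⟧' =
      (c.iso S.X₁ H).hom ≫ hE.boundary c hR
    rw [CategoryTheory.Functor.map_id, Category.comp_id, hδ, ← Category.assoc, Iso.eq_comp_inv,
      Preadditive.neg_comp, c.naturality _ _ S.f H K g h hg hh, Functor.map_neg,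
      Preadditive.comp_neg]

/-- Every triangle of a sequence is a rotation. The sequence `Q ⟶ P ⟶ W` with `P` projective used
for this is an injective presentation of `Q`, which computes the shift of `Q` as `W`. -/
lemma exists_rotate_iso {S : ShortComplex C} (hS : E S) :
    ∃ (T : ShortComplex C) (hT : E T),
      Nonempty (hE.triangle c hS ≅ (hE.triangle c hT).rotate) := by
  obtain ⟨Q, P, i, q, w, hT, hP⟩ := hE.enoughProjectives S.X₃
  have hPI := (hE.projective_iff_injective P).1 hP
  let H : InjectivePresentation E Q := ⟨P, S.X₃, i, q, w, hT, hPI⟩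
  let K := hE.presentation S.X₁
  obtain ⟨k, hk⟩ := hP.exists_lift hS q
  obtain ⟨d, hd⟩ := exists_lift (hE.shortExact _ hS) (i ≫ k) (by rw [Category.assoc, hk, w])
  have hR := hE.invRotated_mem hS w hT hk hd
  obtain ⟨a, b, ha, hb⟩ := hE.exists_comparison hS K (𝟙 _)
  rw [Category.id_comp] at ha
  have hδS : hE.boundary c hS = (c.iso Q H).inv ≫ ((toStable E).map d)⟦(1 : ℤ)⟧' := by
    rw [hE.boundary_eq c hS K ha hb]
    refine (naturality_inv c d H K (g := k ≫ a) (h := b) ?_ ?_).symm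
    · exact (by rw [← Category.assoc, ← hd, Category.assoc, ha] : i ≫ k ≫ a = d ≫ K.ι)
    · exact (by rw [← hk, Category.assoc, hb, Category.assoc] : q ≫ b = (k ≫ a) ≫ K.p)
  have hδR : hE.boundary c hR = (toStable E).map S.g ≫ (c.iso Q H).inv := by
    refine hE.boundary_eq c hR H (a := biprod.snd) (biprod.lift_snd _ _) ?_
    change biprod.desc (-S.f) k ≫ S.g = biprod.snd ≫ q
    ext
    · simp
    · simp [hk]
  have hd' : (toStable E).map d ≫ (toStable E).map biprod.inl =
      (toStable E).map (biprod.lift d i) := by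
    rw [← hE.biprodIso_inv S.X₁ hPI, Iso.comp_inv_eq, biprodIso_hom, ← Functor.map_comp,
      biprod.lift_fst]
  refine ⟨_, hR, ⟨Triangle.isoMk _ _ (-(hE.biprodIso S.X₁ hPI).symm) (Iso.refl _)
    (c.iso Q H).symm ?_ ?_ ?_⟩⟩
  · change (toStable E).map S.f ≫ 𝟙 _ =
      (-(toStable E).map biprod.inl) ≫ (toStable E).map (biprod.desc (-S.f) k)
    rw [Category.comp_id, Preadditive.neg_comp, ← Functor.map_comp, biprod.inl_desc,
      Functor.map_neg, neg_neg]
  · change (toStable E).map S.g ≫ (c.iso Q H).inv = 𝟙 _ ≫ hE.boundary c hR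
    rw [hδR, Category.id_comp]
  · change hE.boundary c hS ≫ (-(toStable E).map biprod.inl)⟦(1 : ℤ)⟧' =
      (c.iso Q H).inv ≫ (-((toStable E).map (biprod.lift d i))⟦(1 : ℤ)⟧')
    rw [hδS, ← hd', Functor.map_neg, Functor.map_comp, Category.assoc, Preadditive.comp_neg]

lemma mem_triangles_iff_rotate_mem (T : Triangle (StableCategory E)) :
    T ∈ hE.triangles c ↔ T.rotate ∈ hE.triangles c := by
  constructor
  · rintro ⟨S, hS, ⟨e⟩⟩
    exact hE.mem_triangles_of_iso c ((rotate _).mapIso e) (hE.rotate_triangle_mem c hS)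
  · rintro ⟨S, hS, ⟨e⟩⟩
    obtain ⟨S', hS', ⟨e'⟩⟩ := hE.exists_rotate_iso c hS
    exact ⟨S', hS', ⟨(triangleRotation (StableCategory E)).functor.preimageIso (e ≪≫ e')⟩⟩

/-- The pretriangulated structure on the stable category whose distinguished triangles are those
isomorphic to triangles of sequences in the class. -/
abbrev pretriangulated : Pretriangulated (StableCategory E) where
  distinguishedTriangles := hE.triangles c
  isomorphic_distinguished _ hT _ e := hE.mem_triangles_of_iso c e hT
  contractible_distinguished X := hE.contractibleTriangle_mem c X
  distinguished_cocone_triangle φ := hE.exists_triangle c φ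
  rotate_distinguished_triangle T := hE.mem_triangles_iff_rotate_mem c T
  complete_distinguished_triangle_morphism T₁ T₂ h₁ h₂ a b h :=
    hE.exists_triangle_hom c T₁ T₂ h₁ h₂ a b h

end IsFrobenius

end Rotation

/-! ### The octahedral axiom -/

section Octahedral

open Pretriangulated Triangulated

variable {C : Type u} [Category.{v} C] [Abelian C] {E : ObjectProperty (ShortComplex C)}

namespace IsFrobenius

variable (hE : IsFrobenius E)
include hE

/-- The cokernels of two inflations and of their composite form a sequence in the class. -/
lemma cokernel_sequence_mem {X₁ X₂ X₃ Z₁₂ Z₂₃ Z₁₃ : C} {u₁₂ : X₁ ⟶ X₂} {u₂₃ : X₂ ⟶ X₃}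
    {v₁₂ : X₂ ⟶ Z₁₂} {v₂₃ : X₃ ⟶ Z₂₃} {v₁₃ : X₃ ⟶ Z₁₃} {w₁₂ : u₁₂ ≫ v₁₂ = 0}
    {w₂₃ : u₂₃ ≫ v₂₃ = 0} {w₁₃ : (u₁₂ ≫ u₂₃) ≫ v₁₃ = 0} (h₁₂ : E (ShortComplex.mk u₁₂ v₁₂ w₁₂))
    (h₂₃ : E (ShortComplex.mk u₂₃ v₂₃ w₂₃)) (h₁₃ : E (ShortComplex.mk (u₁₂ ≫ u₂₃) v₁₃ w₁₃))
    {m₁ : Z₁₂ ⟶ Z₁₃} {m₃ : Z₁₃ ⟶ Z₂₃} (hm₁ : v₁₂ ≫ m₁ = u₂₃ ≫ v₁₃) (hm₃ : v₁₃ ≫ m₃ = v₂₃)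
    (w : m₁ ≫ m₃ = 0) : E (ShortComplex.mk m₁ m₃ w) := by
  have : Epi v₁₂ := (hE.shortExact _ h₁₂).epi_g
  have : Epi v₁₃ := (hE.shortExact _ h₁₃).epi_g
  have : Epi v₂₃ := (hE.shortExact _ h₂₃).epi_g
  have : Epi m₃ := epi_of_epi_fac hm₃
  refine hE.mem_of_exists_desc (S := ShortComplex.mk _ _ _) ?_ ?_
  · intro T k hk
    dsimp at k hk
    obtain ⟨l, hl⟩ := exists_desc (hE.shortExact _ h₂₃) (v₁₃ ≫ k) (by
      dsimp
      rw [← Category.assoc, ← hm₁, Category.assoc, hk, comp_zero])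
    dsimp at l hl
    refine ⟨l, ?_⟩
    dsimp
    rw [← cancel_epi v₁₃, reassoc_of% hm₃, hl]
  · intro J hJ x
    dsimp at x
    obtain ⟨d, hd⟩ := hJ.exists_extension h₂₃ (v₁₂ ≫ x)
    dsimp at d hd
    obtain ⟨d', rfl⟩ := exists_desc (hE.shortExact _ h₁₃) d (by
      dsimp
      rw [Category.assoc, hd, reassoc_of% w₁₂, zero_comp])
    refine ⟨d', ?_⟩
    dsimp at d' hd ⊢
    rw [← cancel_epi v₁₂, reassoc_of% hm₁, hd]

variable [HasShift (StableCategory E) ℤ] [∀ n : ℤ, (shiftFunctor (StableCategory E) n).Additive]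
  (c : ShiftComparison E)

/-- The octahedron of two composable inflations, by naturality of the connecting morphism. -/
lemma octahedron {X₁ X₂ X₃ Z₁₂ Z₂₃ Z₁₃ : C} {u₁₂ : X₁ ⟶ X₂} {u₂₃ : X₂ ⟶ X₃}
    {v₁₂ : X₂ ⟶ Z₁₂} {v₂₃ : X₃ ⟶ Z₂₃} {v₁₃ : X₃ ⟶ Z₁₃} {w₁₂ : u₁₂ ≫ v₁₂ = 0}
    {w₂₃ : u₂₃ ≫ v₂₃ = 0} {w₁₃ : (u₁₂ ≫ u₂₃) ≫ v₁₃ = 0} (h₁₂ : E (ShortComplex.mk u₁₂ v₁₂ w₁₂))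
    (h₂₃ : E (ShortComplex.mk u₂₃ v₂₃ w₂₃)) (h₁₃ : E (ShortComplex.mk (u₁₂ ≫ u₂₃) v₁₃ w₁₃))
    (t₁₃ : Triangle.mk ((toStable E).map u₁₂ ≫ (toStable E).map u₂₃) ((toStable E).map v₁₃)
      (hE.boundary c h₁₃) ∈ hE.triangles c) :
    letI := hE.pretriangulated c
    Nonempty (Octahedron rfl (hE.triangle_mem c h₁₂) (hE.triangle_mem c h₂₃) t₁₃) := by
  have : Epi v₁₂ := (hE.shortExact _ h₁₂).epi_g
  obtain ⟨m₁, hm₁⟩ := exists_desc (hE.shortExact _ h₁₂) (u₂₃ ≫ v₁₃) (by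
    dsimp
    rw [← Category.assoc, w₁₃])
  obtain ⟨m₃, hm₃⟩ := exists_desc (hE.shortExact _ h₁₃) v₂₃ (by
    dsimp
    rw [Category.assoc, w₂₃, comp_zero])
  dsimp at m₁ hm₁ m₃ hm₃
  have w : m₁ ≫ m₃ = 0 := by
    rw [← cancel_epi v₁₂, reassoc_of% hm₁, hm₃, w₂₃, comp_zero]
  have hm := hE.cokernel_sequence_mem h₁₂ h₂₃ h₁₃ hm₁ hm₃ w
  have n₁ := hE.boundary_naturality c h₁₂ h₁₃
    { τ₁ := 𝟙 _, τ₂ := u₂₃, τ₃ := m₁, comm₁₂ := Category.id_comp _, comm₂₃ := hm₁.symm }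
  have n₂ := hE.boundary_naturality c h₁₃ h₂₃
    { τ₁ := u₁₂, τ₂ := 𝟙 _, τ₃ := m₃, comm₁₂ := (Category.comp_id _).symm
      comm₂₃ := (Category.id_comp _).trans hm₃.symm }
  have n₃ := hE.boundary_naturality c h₂₃ hm
    { τ₁ := v₁₂, τ₂ := v₁₃, τ₃ := 𝟙 _, comm₁₂ := hm₁
      comm₂₃ := hm₃.trans (Category.comp_id _).symm }
  dsimp only at n₁ n₂ n₃
  rw [CategoryTheory.Functor.map_id, CategoryTheory.Functor.map_id, Category.comp_id] at n₁
  rw [CategoryTheory.Functor.map_id, Category.id_comp] at n₃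
  let := hE.pretriangulated c
  refine ⟨{ m₁ := (toStable E).map m₁, m₃ := (toStable E).map m₃, comm₁ := ?_, comm₂ := n₁.symm,
            comm₃ := ?_, comm₄ := n₂, mem := ?_ }⟩
  · rw [← Functor.map_comp, ← Functor.map_comp, hm₁]
  · rw [← Functor.map_comp, hm₃]
  · rw [n₃]
    exact hE.triangle_mem c hm

theorem isTriangulated :
    letI := hE.pretriangulated c
    IsTriangulated (StableCategory E) := by
  let := hE.pretriangulated c
  refine IsTriangulated.mk' ?_
  rintro ⟨X₁⟩ ⟨X₂⟩ ⟨X₃⟩ φ ψ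
  obtain ⟨f, rfl⟩ := exists_toStable_map_eq (E := E) (X := X₁) (Y := X₂) φ
  obtain ⟨g, rfl⟩ := exists_toStable_map_eq (E := E) (X := X₂) (Y := X₃) ψ
  -- The two morphisms are replaced by inflations, by adding injective summands to their targets.
  let H := hE.presentation X₁
  let K := hE.presentation (X₂ ⊞ H.I)
  have h₁₂ := hE.cokernel_lift_mem f H
  have h₂₃ := hE.cokernel_lift_mem (biprod.fst ≫ g) K
  have h₁₃ := hE.cokernel_mem (biprod.lift f H.ι ≫ biprod.lift (biprod.fst ≫ g) K.ι) (by
    intro J hJ x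
    obtain ⟨y, rfl⟩ := hJ.exists_extension h₁₂ x
    obtain ⟨z, rfl⟩ := hJ.exists_extension h₂₃ y
    exact ⟨z, Category.assoc _ _ _⟩)
  have t₁₃ : Triangle.mk ((toStable E).map (biprod.lift f H.ι) ≫
      (toStable E).map (biprod.lift (biprod.fst ≫ g) K.ι)) ((toStable E).map (cokernel.π _))
      (hE.boundary c h₁₃) ∈ hE.triangles c := by
    rw [← Functor.map_comp]
    exact hE.triangle_mem c h₁₃
  refine ⟨_, _, _, _, _, _, _, _, Iso.refl _, (hE.biprodIso X₂ H.injective).symm,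
    (hE.biprodIso X₃ K.injective).symm, ?_, ?_, _, _, hE.triangle_mem c h₁₂, _, _,
    hE.triangle_mem c h₂₃, _, _, t₁₃, hE.octahedron c h₁₂ h₂₃ h₁₃ t₁₃⟩
  · change (toStable E).map f ≫ (hE.biprodIso X₂ H.injective).inv =
      𝟙 _ ≫ (toStable E).map (biprod.lift f H.ι)
    rw [Iso.comp_inv_eq, Category.id_comp, biprodIso_hom, ← Functor.map_comp, biprod.lift_fst]
  · change (toStable E).map g ≫ (hE.biprodIso X₃ K.injective).inv =
      (hE.biprodIso X₂ H.injective).inv ≫ (toStable E).map (biprod.lift (biprod.fst ≫ g) K.ι)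
    rw [Iso.comp_inv_eq, Category.assoc, biprodIso_hom, biprodIso_inv, ← Functor.map_comp,
      ← Functor.map_comp, biprod.lift_fst, biprod.inl_fst_assoc]

omit [∀ n : ℤ, (shiftFunctor (StableCategory E) n).Additive] in
/-- Membership in the class of distinguished triangles, with the connecting morphism computed by an
arbitrary injective presentation. -/
lemma mem_triangles_iff (T : Triangle (StableCategory E)) :
    T ∈ hE.triangles c ↔
      ∃ (S : ShortComplex C) (_ : E S) (H : InjectivePresentation E S.X₁)
        (a : S.X₂ ⟶ H.I) (b : S.X₃ ⟶ H.Z), S.f ≫ a = H.ι ∧ S.g ≫ b = a ≫ H.p ∧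
        Nonempty (T ≅ Triangle.mk ((toStable E).map S.f) ((toStable E).map S.g)
          ((toStable E).map b ≫ (c.iso S.X₁ H).inv)) := by
  constructor
  · rintro ⟨S, hS, ⟨e⟩⟩
    obtain ⟨a, b, ha, hb⟩ := hE.exists_comparison hS (hE.presentation S.X₁) (𝟙 _)
    rw [Category.id_comp] at ha
    refine ⟨S, hS, hE.presentation S.X₁, a, b, ha, hb, ⟨?_⟩⟩
    rw [← hE.boundary_eq c hS (hE.presentation S.X₁) ha hb]
    exact e
  · rintro ⟨S, hS, H, a, b, ha, hb, ⟨e⟩⟩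
    refine ⟨S, hS, ⟨?_⟩⟩
    rw [triangle, hE.boundary_eq c hS H ha hb]
    exact e

end IsFrobenius

end Octahedral

end RelStable

open RelStable Pretriangulated in
theorem mainTheorem5 {A : Type u} [Category.{v} A] [Abelian A]
    {B : Type u'} [Category.{v'} B] [Abelian B]
    (F : A ⥤ B) [F.Faithful] [F.IsLeftAdjoint] [F.IsRightAdjoint] :
    IsExactStructure (SplitBy F) ∧
    HasEnoughRelProjectives (SplitBy F) ∧
    HasEnoughRelInjectives (SplitBy F) ∧
    (∀ P : A, IsRelProjective (SplitBy F) P ↔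
      ∃ (Y : B) (Q : A), Nonempty (P ⊞ Q ≅ F.leftAdjoint.obj Y)) ∧
    (∀ I : A, IsRelInjective (SplitBy F) I ↔
      ∃ (Y : B) (J : A), Nonempty (I ⊞ J ≅ F.rightAdjoint.obj Y)) ∧
    ((∀ X : A, IsRelProjective (SplitBy F) X ↔ IsRelInjective (SplitBy F) X) →
      ∃ (_ : HasShift (StableCategory (SplitBy F)) ℤ)
        (_ : ∀ n : ℤ, (shiftFunctor (StableCategory (SplitBy F)) n).Additive)
        (_ : Pretriangulated (StableCategory (SplitBy F)))
        (e : ∀ (X : A) (H : InjectivePresentation (SplitBy F) X),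
          ((toStable (SplitBy F)).obj X)⟦(1 : ℤ)⟧ ≅ (toStable (SplitBy F)).obj H.Z),
        IsTriangulated (StableCategory (SplitBy F)) ∧
        (∀ (X Y : A) (f : X ⟶ Y) (H : InjectivePresentation (SplitBy F) X)
          (K : InjectivePresentation (SplitBy F) Y) (g : H.I ⟶ K.I) (h : H.Z ⟶ K.Z),
          H.ι ≫ g = f ≫ K.ι → H.p ≫ h = g ≫ K.p →
          ((toStable (SplitBy F)).map f)⟦(1 : ℤ)⟧' ≫ (e Y K).hom =
            (e X H).hom ≫ (toStable (SplitBy F)).map h) ∧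
        (∀ T : Triangle (StableCategory (SplitBy F)),
          T ∈ distTriang (StableCategory (SplitBy F)) ↔
          ∃ (S : ShortComplex A) (_ : SplitBy F S)
            (H : InjectivePresentation (SplitBy F) S.X₁) (a : S.X₂ ⟶ H.I) (b : S.X₃ ⟶ H.Z),
            S.f ≫ a = H.ι ∧ S.g ≫ b = a ≫ H.p ∧
            Nonempty (T ≅ Triangle.mk ((toStable (SplitBy F)).map S.f)
              ((toStable (SplitBy F)).map S.g)
              ((toStable (SplitBy F)).map b ≫ (e S.X₁ H).inv)))) := by
  have hd := splitBy_isDetected F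
  refine ⟨hd.isExactStructure, hd.enoughProjectives, hd.enoughInjectives, isRelProjective_iff F,
    isRelInjective_iff F, fun h => ?_⟩
  have hE : IsFrobenius (SplitBy F) := { hd with projective_iff_injective := h }
  obtain ⟨sh, add, e, he⟩ := hE.exists_shift
  let c : ShiftComparison (SplitBy F) := ⟨e, he⟩
  exact ⟨sh, add, hE.pretriangulated c, e, hE.isTriangulated c, he, hE.mem_triangles_iff c⟩
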